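/- A polynomial knot is a smooth embedding $\kappa:\mathbb R\to\mathbb R^3$ whose components are polynomials; its degree $d$ is the maximum of the degrees of its components. Such a $\kappa$ extends to an embedding $\bar\kappa$ of the circle $S^1=\mathbb R\cup\{\infty\}$ in $S^3=\mathbb R^3\cup\{\infty\}$ with $\bar\kappa(\infty)=\infty$. Two embeddings $\alpha_0,\alpha_1:S^1\to S^3$ have the same knot type if $\alpha_0=g\circ\alpha_1\circ f$ for orientation-preserving homeomorphisms $f$ of $S^1$ and $g$ of $S^3$. The bridge number $b$ of $\kappa$ is the minimum number of local maxima of $K'$ in the direction $v$ (that is, of the function $\langle v,\cdot\rangle$ along $K'$), over all embedded closed curves $K':S^1\to\mathbb R^3\subset S^3$ with the same knot type as $\bar\kappa$ and all directions $v\neq 0$. Proposition. If $\kappa$ is a polynomial knot of degree $d\ge 3$, then its bridge number $b$ is finite and $$ b\le \tfrac12(d-1). $$ -/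

import Mathlib

open Polynomial Filter Topology CategoryTheory

noncomputable section

/-- Real Euclidean `n`-space. -/
abbrev EucSpace (n : ℕ) : Type := EuclideanSpace ℝ (Fin n)

/-- The `n`-sphere, as the one-point compactification of Euclidean `n`-space. -/
abbrev SphereOf (n : ℕ) : Type := OnePoint (EucSpace n)

/-- The circle, as the one-point compactification of the real line. -/
abbrev CircleOf : Type := OnePoint ℝ

/-- A homeomorphism `h` of a space `X` (an oriented `n`-sphere) is orientation preserving if it
induces the identity on the `n`-th singular homology group `H_n(X; ℤ)`, that is, has degree `1`. -/
def IsOrientationPreserving (n : ℕ) {X : Type} [TopologicalSpace X] (h : X ≃ₜ X) : Prop :=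
  ((AlgebraicTopology.singularHomologyFunctor (ModuleCat.{0} ℤ) n).obj
      (ModuleCat.of ℤ ℤ)).map (TopCat.ofHom (h : C(X, X))) = 𝟙 _

/-- A topological knot: a continuous embedding of the circle in the `n`-sphere. -/
structure TopKnot (n : ℕ) where
  toFun : CircleOf → SphereOf n
  isEmbedding : IsEmbedding toFun

/-- Two topological knots have the same knot type if they differ by orientation-preserving
homeomorphisms of the circle and of the sphere. -/
def TopKnot.Equivalent {n : ℕ} (K₀ K₁ : TopKnot n) : Prop :=
  ∃ (f : CircleOf ≃ₜ CircleOf) (g : SphereOf n ≃ₜ SphereOf n),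
    IsOrientationPreserving 1 f ∧ IsOrientationPreserving n g ∧
      K₀.toFun = g ∘ K₁.toFun ∘ f

/-- A closed knot that lies in Euclidean `n`-space. -/
structure SpaceKnot (n : ℕ) where
  toFun : CircleOf → EucSpace n
  isEmbedding : IsEmbedding toFun

/-- A closed knot in Euclidean space, regarded as a knot in the sphere. -/
def SpaceKnot.toTopKnot {n : ℕ} (K : SpaceKnot n) : TopKnot n where
  toFun s := (K.toFun s : SphereOf n)
  isEmbedding := OnePoint.isOpenEmbedding_coe.isEmbedding.comp K.isEmbedding

/-- The number (possibly infinite) of local maxima of a closed knot in the direction `v`. -/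
def SpaceKnot.numLocalMax {n : ℕ} (K : SpaceKnot n) (v : EucSpace n) : ℕ∞ :=
  {s : CircleOf | IsLocalMax (fun s => inner ℝ v (K.toFun s)) s}.encard

/-- The bridge number of a topological knot `K` in the three-sphere: the minimum number of local
maxima of `K'` in the direction `v`, over all `K'` in three-space with the same knot type as `K`
and all directions `v`. (It is `⊤` if every such number is infinite.) -/
def TopKnot.bridgeNumber (K : TopKnot 3) : ℕ∞ :=
  ⨅ (K' : SpaceKnot 3) (_ : K'.toTopKnot.Equivalent K) (v : EucSpace 3) (_ : v ≠ 0),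
    K'.numLocalMax v

/-- The parametrized curve in Euclidean `n`-space with the given polynomial components. -/
def polyCurve {n : ℕ} (p : Fin n → ℝ[X]) (t : ℝ) : EucSpace n :=
  WithLp.toLp 2 fun i => (p i).eval t

/-- A polynomial knot: a smooth embedding of the line in Euclidean `n`-space (a topological
embedding with nowhere vanishing derivative) whose components are polynomials. -/
structure PolyKnot (n : ℕ) where
  comp : Fin n → ℝ[X]
  isEmbedding : IsEmbedding (polyCurve comp)
  deriv_ne_zero : ∀ t : ℝ, deriv (polyCurve comp) t ≠ 0

/-- The degree of a polynomial knot: the maximum of the degrees of its components. -/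
def PolyKnot.degree {n : ℕ} (κ : PolyKnot n) : ℕ :=
  Finset.univ.sup fun i => (κ.comp i).natDegree

theorem PolyKnot.tendsto_cocompact {n : ℕ} (κ : PolyKnot n) :
    Tendsto (polyCurve κ.comp) (cocompact ℝ) (cocompact (EucSpace n)) := by
  obtain ⟨i, hi⟩ : ∃ i, 0 < (κ.comp i).degree := by
    by_contra! h
    have h01 : polyCurve κ.comp 0 = polyCurve κ.comp 1 := by
      unfold polyCurve
      congr 1
      funext i
      rw [Polynomial.eq_C_of_degree_le_zero (h i)]
      simp
    exact zero_ne_one (κ.isEmbedding.injective h01)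
  refine tendsto_cocompact_of_tendsto_dist_comp_atTop 0 ?_
  have key : Tendsto (fun t : ℝ => ‖(κ.comp i).eval t‖) (cocompact ℝ) atTop :=
    Polynomial.tendsto_norm_atTop (κ.comp i) hi tendsto_norm_cocompact_atTop
  refine tendsto_atTop_mono (fun t => ?_) key
  rw [dist_zero_right]
  exact PiLp.norm_apply_le (polyCurve κ.comp t) i

/-- The one-point compactification of a polynomial knot, which sends `∞` to `∞`. -/
def PolyKnot.completion {n : ℕ} (κ : PolyKnot n) : TopKnot n where
  toFun := OnePoint.map (polyCurve κ.comp)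
  isEmbedding := by
    refine (Continuous.isClosedEmbedding ?_ ?_).isEmbedding
    · refine OnePoint.continuous_map κ.isEmbedding.continuous ?_
      simpa only [coclosedCompact_eq_cocompact] using κ.tendsto_cocompact
    · exact Option.map_injective κ.isEmbedding.injective

end

/-! The coefficients of `t ^ d` and `t ^ (d - 1)` in the height `⟨v, κ(t)⟩` are two linear forms in
`v`, so some `v ≠ 0` in three-space kills both, and the height `P` in that direction has degree `e ≤
d - 2` (`PolyKnot.exists_natDegree_heightPoly_le`). If `e > 0`, then after a change of sign `P → +∞`
at `+∞`. Each of its `m` local maxima is then followed by a critical point that is not a local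
maximum, so `P'` has at least `2m` roots and `2m + 1 ≤ e` (`Polynomial.encard_isLocalMax_le`).

The knot passes through `∞`, so it must be moved into `ℝ³`; doing this at the cost of at most one
new local maximum (`hasClosing_of_polynomial_height`) gives `b ≤ m + 1`, and `2(m + 1) + 1 ≤ e + 2 ≤
d`. To move it, slicewise affine maps of `ℂ × ℝ` first put the two ends in a standard position. Then
a homeomorphism fixing a large ball drags `∞` to a finite point. It is a ball shift conjugated by
inversion in the sup norm, so the new heights are explicit. If `P` is constant, the curve is planar;
a shear makes its height strictly monotone, so `b ≤ 1` (`hasClosing_of_planar`).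

All ambient maps are homotopic to the identity, so homotopy invariance of homology makes them
orientation preserving; no degree is ever computed. -/

noncomputable section

/-! ### Orientation through homotopies to the identity. -/

/-- A homeomorphism homotopic to the identity preserves the orientation. -/
theorem isOrientationPreserving_of_homotopic (n : ℕ) {X : Type} [TopologicalSpace X] {h : X ≃ₜ X}
    (hh : (h : C(X, X)).Homotopic (ContinuousMap.id X)) : IsOrientationPreserving n h := by
  obtain ⟨H⟩ := hh
  have H' : TopCat.Homotopy (TopCat.ofHom (h : C(X, X))) (𝟙 (TopCat.of X)) := H
  have := H'.congr_homologyMap_singularChainComplexFunctor (ModuleCat.of ℤ ℤ) n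
  refine this.trans ?_
  exact CategoryTheory.Functor.map_id
    (((AlgebraicTopology.singularHomologyFunctor (ModuleCat.{0} ℤ) n).obj (ModuleCat.of ℤ ℤ))) _

/-- A homeomorphism that is homotopic to the identity. -/
def Homeomorph.HomotopicToId {X : Type*} [TopologicalSpace X] (h : X ≃ₜ X) : Prop :=
  (h : C(X, X)).Homotopic (ContinuousMap.id X)

theorem Homeomorph.HomotopicToId.trans {X : Type*} [TopologicalSpace X] {g h : X ≃ₜ X}
    (hg : g.HomotopicToId) (hh : h.HomotopicToId) : (g.trans h).HomotopicToId :=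
  ContinuousMap.Homotopic.comp hh hg

theorem Homeomorph.HomotopicToId.conj {X Y : Type*} [TopologicalSpace X] [TopologicalSpace Y]
    {h : Y ≃ₜ Y} (hh : h.HomotopicToId) (e : X ≃ₜ Y) :
    ((e.trans h).trans e.symm).HomotopicToId := by
  have h1 := ContinuousMap.Homotopic.comp (ContinuousMap.Homotopic.refl (e.symm : C(Y, X)))
    (ContinuousMap.Homotopic.comp hh (ContinuousMap.Homotopic.refl (e : C(X, Y))))
  have h2 : (e.symm : C(Y, X)).comp ((ContinuousMap.id Y).comp (e : C(X, Y)))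
      = ContinuousMap.id X := by
    ext x; simp
  rw [h2] at h1
  exact h1

/-- A uniformly proper family of maps from a homeomorphism to the identity extends to the one-point
compactification. -/
theorem homotopicToId_onePointCongr {X : Type*} [TopologicalSpace X] [T2Space X] (h : X ≃ₜ X)
    (F : unitInterval → X → X) (hF : Continuous (Function.uncurry F))
    (h0 : ∀ x, F 0 x = h x) (h1 : ∀ x, F 1 x = x)
    (hp : ∀ K : Set X, IsCompact K → ∃ K' : Set X, IsCompact K' ∧ ∀ s x, F s x ∈ K → x ∈ K') :
    h.onePointCongr.HomotopicToId := by
  refine ⟨⟨⟨fun q => OnePoint.map (F q.1) q.2, ?_⟩, ?_, ?_⟩⟩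
  · rw [continuous_iff_continuousAt]
    rintro ⟨s, x⟩
    induction x using OnePoint.rec with
    | infty =>
      simp only [ContinuousAt, OnePoint.map_infty]
      rw [tendsto_def]
      intro V hV
      rw [OnePoint.hasBasis_nhds_infty.mem_iff] at hV
      obtain ⟨K, ⟨-, hK⟩, hKV⟩ := hV
      -- `K'` serves every time `s` at once, so the neighbourhood of `(s, ∞)` can be the whole
      -- interval times a neighbourhood of `∞`.
      obtain ⟨K', hK', hsub⟩ := hp K hK
      have hm : ((↑) '' K'ᶜ ∪ {OnePoint.infty} : Set (OnePoint X)) ∈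
          𝓝 (OnePoint.infty : OnePoint X) :=
        OnePoint.hasBasis_nhds_infty.mem_of_mem ⟨hK'.isClosed, hK'⟩
      rw [nhds_prod_eq]
      filter_upwards [prod_mem_prod univ_mem hm]
      rintro ⟨s', y⟩ ⟨-, hy⟩
      apply hKV
      rcases hy with ⟨y, hy, rfl⟩ | rfl
      · left
        exact ⟨F s' y, fun hc => hy (hsub _ _ hc), rfl⟩
      · right; rfl
    | coe x =>
      simp only [ContinuousAt, OnePoint.map_some]
      rw [nhds_prod_eq, OnePoint.nhds_coe_eq]
      have : 𝓝 s ×ˢ Filter.map ((↑) : X → OnePoint X) (𝓝 x)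
          = Filter.map (Prod.map id ((↑) : X → OnePoint X)) (𝓝 s ×ˢ 𝓝 x) := by
        rw [← Filter.prod_map_map_eq', Filter.map_id]
      rw [this, tendsto_map'_iff, ← nhds_prod_eq]
      exact (OnePoint.continuous_coe.comp hF).continuousAt
  · intro x
    induction x using OnePoint.rec with
    | infty => rfl
    | coe x => exact congrArg _ (h0 x)
  · intro x
    induction x using OnePoint.rec with
    | infty => rfl
    | coe x => exact congrArg _ (h1 x)

/-! ### Inversion and dragging the point at infinity. -/

section Inversion

variable {V : Type*} [NormedAddCommGroup V] [NormedSpace ℝ V]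

open Classical in
/-- Inversion in the unit sphere, on the one-point compactification of a normed space. -/
def normInversionFun : OnePoint V → OnePoint V
  | OnePoint.infty => ((0 : V) : OnePoint V)
  | OnePoint.some x => if x = 0 then OnePoint.infty else ((‖x‖⁻¹ ^ 2 • x : V) : OnePoint V)

theorem normInversionFun_infty : normInversionFun (OnePoint.infty : OnePoint V) = (0 : V) := rfl

theorem normInversionFun_zero : normInversionFun ((0 : V) : OnePoint V) = OnePoint.infty :=
  if_pos rfl

theorem normInversionFun_coe {x : V} (hx : x ≠ 0) :
    normInversionFun (x : OnePoint V) = ((‖x‖⁻¹ ^ 2 • x : V) : OnePoint V) := if_neg hx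

theorem norm_inversion {x : V} (hx : x ≠ 0) : ‖‖x‖⁻¹ ^ 2 • x‖ = ‖x‖⁻¹ := by
  have := norm_ne_zero_iff.2 hx
  rw [norm_smul, norm_pow, norm_inv, norm_norm]
  field_simp

theorem inversion_ne_zero {x : V} (hx : x ≠ 0) : ‖x‖⁻¹ ^ 2 • x ≠ 0 := by
  rw [← norm_ne_zero_iff, norm_inversion hx]
  exact inv_ne_zero (norm_ne_zero_iff.2 hx)

theorem normInversionFun_involutive : Function.Involutive (normInversionFun (V := V)) := by
  intro x
  induction x using OnePoint.rec with
  | infty => rw [normInversionFun_infty, normInversionFun_zero]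
  | coe x =>
    by_cases hx : x = 0
    · subst hx; rw [normInversionFun_zero, normInversionFun_infty]
    · rw [normInversionFun_coe hx, normInversionFun_coe (inversion_ne_zero hx), norm_inversion hx,
        smul_smul]
      have := norm_ne_zero_iff.2 hx
      congr 1
      rw [inv_inv, ← mul_pow, mul_inv_cancel₀ this, one_pow, one_smul]

theorem continuous_normInversionFun [ProperSpace V] : Continuous (normInversionFun (V := V)) := by
  rw [continuous_iff_continuousAt]
  intro x
  induction x using OnePoint.rec with
  | infty =>
    rw [OnePoint.continuousAt_infty', coclosedCompact_eq_cocompact, normInversionFun_infty]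
    have h1 : Tendsto (fun x : V => ‖x‖⁻¹ ^ 2 • x) (cocompact V) (𝓝 0) := by
      rw [tendsto_zero_iff_norm_tendsto_zero]
      refine (tendsto_inv_atTop_zero.comp (tendsto_norm_cocompact_atTop (E := V))).congr ?_
      intro x
      by_cases hx : x = 0
      · simp [hx]
      · exact (norm_inversion hx).symm
    refine ((OnePoint.continuous_coe.tendsto (0 : V)).comp h1).congr' ?_
    have : ∀ᶠ x in cocompact V, 1 ≤ ‖x‖ :=
      (tendsto_norm_cocompact_atTop (E := V)).eventually_ge_atTop 1
    filter_upwards [this] with x hx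
    have : x ≠ 0 := by rintro rfl; norm_num at hx
    simp [normInversionFun_coe this]
  | coe x =>
    rw [OnePoint.continuousAt_coe]
    by_cases hx : x = 0
    · subst hx
      rw [ContinuousAt, ← nhdsNE_sup_pure, Function.comp_apply, normInversionFun_zero]
      refine Tendsto.sup ?_ ?_
      · have h1 : Tendsto (fun x : V => ‖x‖⁻¹ ^ 2 • x) (𝓝[≠] 0) (cocompact V) := by
          refine tendsto_cocompact_of_tendsto_dist_comp_atTop 0 ?_
          refine (tendsto_inv_nhdsGT_zero.comp (tendsto_norm_nhdsNE_zero (E := V))).congr' ?_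
          filter_upwards [self_mem_nhdsWithin] with x hx
          simp only [dist_zero_right, norm_inversion hx, Function.comp_apply]
        rw [← coclosedCompact_eq_cocompact] at h1
        refine (OnePoint.tendsto_coe_infty.comp h1).congr' ?_
        filter_upwards [self_mem_nhdsWithin] with x hx
        simp [normInversionFun_coe hx]
      · rw [tendsto_pure_left]
        intro s hs
        simpa [normInversionFun_zero] using mem_of_mem_nhds hs
    · have h1 : ContinuousAt (fun x : V => ((‖x‖⁻¹ ^ 2 • x : V) : OnePoint V)) x := by
        have := norm_ne_zero_iff.2 hx
        refine OnePoint.continuous_coe.continuousAt.comp ?_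
        exact ((continuous_norm.continuousAt.inv₀ this).pow 2).smul continuousAt_id
      refine h1.congr ?_
      filter_upwards [isOpen_ne.mem_nhds hx] with y hy
      simp [normInversionFun_coe hy]

/-- Inversion in the unit sphere, as a homeomorphism. -/
def normInversion [ProperSpace V] : OnePoint V ≃ₜ OnePoint V where
  toEquiv := normInversionFun_involutive.toPerm
  continuous_toFun := continuous_normInversionFun
  continuous_invFun := continuous_normInversionFun

/-- The map that moves the centre of the unit ball to `c` and fixes the rest of the space. -/
def ballShift (c : V) (x : V) : V := x + max 0 (1 - ‖x‖) • c

theorem continuous_ballShift : Continuous fun q : V × V => ballShift q.1 q.2 := by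
  unfold ballShift
  fun_prop

theorem ballShift_of_one_le {c x : V} (hx : 1 ≤ ‖x‖) : ballShift c x = x := by
  simp [ballShift, hx]

theorem norm_ballShift_sub_le (c x : V) : ‖ballShift c x - x‖ ≤ ‖c‖ := by
  have : |max 0 (1 - ‖x‖)| ≤ 1 := by
    rw [abs_of_nonneg (le_max_left _ _)]
    exact max_le zero_le_one (by linarith [norm_nonneg x])
  rw [ballShift, add_sub_cancel_left, norm_smul, Real.norm_eq_abs]
  exact mul_le_of_le_one_left (norm_nonneg c) this

/-- The displacement `max 0 (1 - ‖x‖) • c` is `‖c‖`-Lipschitz. For `‖c‖ < 1` the shift is thus the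
identity plus a contraction, hence a homeomorphism without an explicit inverse. -/
theorem approximatesLinearOn_ballShift (c : V) :
    ApproximatesLinearOn (ballShift c) ((ContinuousLinearEquiv.refl ℝ V : V ≃L[ℝ] V) : V →L[ℝ] V)
      Set.univ ‖c‖₊ := by
  intro x _ y _
  have h : ballShift c x - ballShift c y - (x - y)
      = (max 0 (1 - ‖x‖) - max 0 (1 - ‖y‖)) • c := by
    simp only [ballShift, sub_smul]; abel
  have h2 : |max 0 (1 - ‖x‖) - max 0 (1 - ‖y‖)| ≤ ‖x - y‖ := by
    refine (abs_max_sub_max_le_abs _ _ 0 |>.trans' (by rw [max_comm, max_comm 0])).trans ?_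
    rw [show 1 - ‖x‖ - (1 - ‖y‖) = ‖y‖ - ‖x‖ by ring, norm_sub_rev]
    exact abs_norm_sub_norm_le y x
  simp only [ContinuousLinearEquiv.coe_refl, ContinuousLinearMap.coe_id', id_eq]
  rw [h, norm_smul, mul_comm, coe_nnnorm]
  exact mul_le_mul_of_nonneg_left h2 (norm_nonneg c)

/-- `ballShift c` as a homeomorphism. -/
def ballShiftHomeo [CompleteSpace V] [Nontrivial V] (c : V) (hc : ‖c‖ < 1) : V ≃ₜ V :=
  (approximatesLinearOn_ballShift c).toHomeomorph _ <| Or.inr <| by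
    have : ‖((ContinuousLinearEquiv.refl ℝ V).symm : V →L[ℝ] V)‖₊ = 1 :=
      NNReal.eq (ContinuousLinearMap.norm_id (𝕜 := ℝ) (E := V))
    rw [this, inv_one]
    exact hc

theorem ballShiftHomeo_apply [CompleteSpace V] [Nontrivial V] (c : V) (hc : ‖c‖ < 1) (x : V) :
    ballShiftHomeo c hc x = ballShift c x := rfl

theorem homotopicToId_ballShiftHomeo [ProperSpace V] [Nontrivial V] (c : V) (hc : ‖c‖ < 1) :
    (ballShiftHomeo c hc).onePointCongr.HomotopicToId := by
  refine homotopicToId_onePointCongr _ (fun s x => ballShift ((1 - (s : ℝ)) • c) x) ?_ ?_ ?_ ?_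
  · exact continuous_ballShift.comp (f := fun q : unitInterval × V => ((1 - (q.1 : ℝ)) • c, q.2))
      (by fun_prop)
  · intro x; simp [ballShiftHomeo_apply]
  · intro x; simp [ballShift]
  · intro K hK
    obtain ⟨R, hR⟩ := hK.isBounded.subset_closedBall (0 : V)
    refine ⟨Metric.closedBall 0 (R + 1), isCompact_closedBall _ _, fun s x hx => ?_⟩
    have h1 := hR hx
    rw [mem_closedBall_zero_iff] at h1 ⊢
    have h2 := norm_ballShift_sub_le ((1 - (s : ℝ)) • c) x
    have h3 : ‖(1 - (s : ℝ)) • c‖ ≤ ‖c‖ := by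
      rw [norm_smul, Real.norm_eq_abs, abs_of_nonneg (by linarith [s.2.2])]
      exact mul_le_of_le_one_left (norm_nonneg c) (by linarith [s.2.1])
    have h4 := norm_sub_norm_le x (ballShift ((1 - (s : ℝ)) • c) x)
    rw [norm_sub_rev] at h4
    linarith

/-- The homeomorphism of the one-point compactification that fixes the unit ball and drags the
point at infinity to the inverse of `c`. -/
def dragInfinity [ProperSpace V] [Nontrivial V] (c : V) (hc : ‖c‖ < 1) :
    OnePoint V ≃ₜ OnePoint V :=
  (normInversion.trans (ballShiftHomeo c hc).onePointCongr).trans normInversion.symm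

theorem homotopicToId_dragInfinity [ProperSpace V] [Nontrivial V] (c : V) (hc : ‖c‖ < 1) :
    (dragInfinity c hc).HomotopicToId :=
  (homotopicToId_ballShiftHomeo c hc).conj _

variable [ProperSpace V] [Nontrivial V] {c : V} (hc : ‖c‖ < 1)

theorem dragInfinity_apply (x : OnePoint V) : dragInfinity c hc x
    = normInversionFun (OnePoint.map (ballShift c) (normInversionFun x)) := rfl

theorem dragInfinity_infty (h0 : c ≠ 0) :
    dragInfinity c hc OnePoint.infty = ((‖c‖⁻¹ ^ 2 • c : V) : OnePoint V) := by
  have h : ballShift c 0 = c := by simp [ballShift]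
  rw [dragInfinity_apply, normInversionFun_infty, OnePoint.map_some, h, normInversionFun_coe h0]

theorem dragInfinity_of_norm_le {x : V} (hx : ‖x‖ ≤ 1) : dragInfinity c hc x = x := by
  by_cases h0 : x = 0
  · subst h0
    rw [dragInfinity_apply, normInversionFun_zero, OnePoint.map_infty, normInversionFun_infty]
  · rw [dragInfinity_apply, normInversionFun_coe h0, OnePoint.map_some, ballShift_of_one_le,
      ← normInversionFun_coe h0, normInversionFun_involutive]
    rw [norm_inversion h0]
    exact (one_le_inv₀ (norm_pos_iff.2 h0)).2 hx

/-- Outside the unit ball the first inversion lands where the shift is active. Naming the shifted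
point `y` leaves the caller only `‖y‖` to compute. -/
theorem dragInfinity_of_le_norm {x y : V} (hx : 1 ≤ ‖x‖)
    (hy : ‖x‖⁻¹ ^ 2 • x + (1 - ‖x‖⁻¹) • c = y) (h0 : y ≠ 0) :
    dragInfinity c hc x = ((‖y‖⁻¹ ^ 2 • y : V) : OnePoint V) := by
  have hx0 : x ≠ 0 := by rintro rfl; norm_num at hx
  have : ballShift c (‖x‖⁻¹ ^ 2 • x) = y := by
    rw [ballShift, norm_inversion hx0, max_eq_right, hy]
    exact sub_nonneg.2 (inv_le_one_of_one_le₀ hx)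
  rw [dragInfinity_apply, normInversionFun_coe hx0, OnePoint.map_some, this,
    normInversionFun_coe h0]

end Inversion

/-! ### Homeomorphisms of `ℂ × ℝ` that straighten curves. -/

/-- A jointly continuous left inverse gives uniform properness: the preimages of `K` at all times
lie in the compact image of `[0, 1] × K` under `G`. -/
theorem homotopicToId_onePointCongr_of_leftInverse {X : Type*} [TopologicalSpace X] [T2Space X]
    (h : X ≃ₜ X) (F G : unitInterval → X → X) (hF : Continuous (Function.uncurry F))
    (hG : Continuous (Function.uncurry G)) (hGF : ∀ s x, G s (F s x) = x)
    (h0 : ∀ x, F 0 x = h x) (h1 : ∀ x, F 1 x = x) :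
    h.onePointCongr.HomotopicToId := by
  refine homotopicToId_onePointCongr h F hF h0 h1 fun K hK =>
    ⟨Function.uncurry G '' (Set.univ ×ˢ K), (isCompact_univ.prod hK).image hG, fun s x hx => ?_⟩
  exact ⟨(s, F s x), ⟨Set.mem_univ _, hx⟩, hGF s x⟩

/-- The homeomorphism of `ℂ × ℝ` that acts on the slice at height `z` by
`w ↦ u z * (w - m z)`. -/
def sliceAffine (m u : C(ℝ, ℂ)) (hu : ∀ z, u z ≠ 0) : ℂ × ℝ ≃ₜ ℂ × ℝ where
  toFun q := (u q.2 * (q.1 - m q.2), q.2)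
  invFun q := (q.1 / u q.2 + m q.2, q.2)
  left_inv q := by
    ext1
    · simp only; rw [mul_div_cancel_left₀ _ (hu _)]; ring
    · rfl
  right_inv q := by
    ext1
    · simp only; rw [add_sub_cancel_right, mul_div_cancel₀ _ (hu _)]
    · rfl
  continuous_toFun := by fun_prop
  continuous_invFun := by
    have : Continuous fun q : ℂ × ℝ => q.1 / u q.2 :=
      continuous_fst.div (by fun_prop) fun q => hu _
    fun_prop

theorem sliceAffine_apply (m u : C(ℝ, ℂ)) (hu : ∀ z, u z ≠ 0) (q : ℂ × ℝ) :
    sliceAffine m u hu q = (u q.2 * (q.1 - m q.2), q.2) := rfl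

/-- Contracting `z` to `0` turns `u` into the constant `u 0`, while the factor `exp (-s log (u 0))`
brings that constant to `1`; meanwhile `m` is scaled to `0`. -/
theorem homotopicToId_sliceAffine (m u : C(ℝ, ℂ)) (hu : ∀ z, u z ≠ 0) :
    (sliceAffine m u hu).onePointCongr.HomotopicToId := by
  let U : unitInterval → ℝ → ℂ := fun s z =>
    u ((1 - (s : ℝ)) * z) * Complex.exp (-((s : ℝ) : ℂ) * Complex.log (u 0))
  have hU : ∀ s z, U s z ≠ 0 := fun s z => mul_ne_zero (hu _) (Complex.exp_ne_zero _)
  have hUc : Continuous fun p : unitInterval × (ℂ × ℝ) => U p.1 p.2.2 := by fun_prop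
  refine homotopicToId_onePointCongr_of_leftInverse _
    (fun s q => (U s q.2 * (q.1 - ((1 - (s : ℝ) : ℝ) : ℂ) * m q.2), q.2))
    (fun s q => (q.1 / U s q.2 + ((1 - (s : ℝ) : ℝ) : ℂ) * m q.2, q.2)) ?_ ?_ ?_ ?_ ?_
  · simp only [Function.uncurry_def]
    refine (hUc.mul ?_).prodMk (by fun_prop)
    fun_prop
  · simp only [Function.uncurry_def]
    refine Continuous.prodMk (Continuous.add ?_ ?_) (by fun_prop)
    · exact Continuous.div (by fun_prop) hUc fun q => hU _ _
    · fun_prop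
  · intro s q
    ext1
    · simp only; rw [mul_div_cancel_left₀ _ (hU _ _)]; ring
    · rfl
  · intro q
    simp [sliceAffine_apply, U]
  · intro q
    simp [U, Complex.exp_neg, Complex.exp_log (hu 0), hu 0]

/-- The shear `(w, z) ↦ (w, z + F w)` of `ℂ × ℝ`. -/
def verticalShear (F : C(ℂ, ℝ)) : ℂ × ℝ ≃ₜ ℂ × ℝ where
  toFun q := (q.1, q.2 + F q.1)
  invFun q := (q.1, q.2 - F q.1)
  left_inv q := by simp
  right_inv q := by simp
  continuous_toFun := by fun_prop
  continuous_invFun := by fun_prop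

theorem verticalShear_apply (F : C(ℂ, ℝ)) (q : ℂ × ℝ) :
    verticalShear F q = (q.1, q.2 + F q.1) := rfl

theorem homotopicToId_verticalShear (F : C(ℂ, ℝ)) :
    (verticalShear F).onePointCongr.HomotopicToId := by
  refine homotopicToId_onePointCongr_of_leftInverse _
    (fun s q => (q.1, q.2 + (1 - (s : ℝ)) * F q.1))
    (fun s q => (q.1, q.2 - (1 - (s : ℝ)) * F q.1)) ?_ ?_ ?_ ?_ ?_
  · simp only [Function.uncurry_def]; fun_prop
  · simp only [Function.uncurry_def]; fun_prop
  · intro s q; simp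
  · intro q; simp [verticalShear_apply]
  · intro q; simp

/-! ### Local maxima created by closing a curve with standard ends. -/

theorem not_isLocalMax_of_eventually_gt_right {f : ℝ → ℝ} {t : ℝ}
    (h : ∀ᶠ x in 𝓝[>] t, f t < f x) : ¬ IsLocalMax f t := by
  intro hm
  have h2 : ∀ᶠ x in 𝓝[>] t, f x ≤ f t := hm.filter_mono nhdsWithin_le_nhds
  obtain ⟨x, h3, h4⟩ := (h.and h2).exists
  exact absurd h3 h4.not_gt

theorem not_isLocalMax_of_eventually_gt_left {f : ℝ → ℝ} {t : ℝ}
    (h : ∀ᶠ x in 𝓝[<] t, f t < f x) : ¬ IsLocalMax f t := by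
  intro hm
  have h2 : ∀ᶠ x in 𝓝[<] t, f x ≤ f t := hm.filter_mono nhdsWithin_le_nhds
  obtain ⟨x, h3, h4⟩ := (h.and h2).exists
  exact absurd h3 h4.not_gt

theorem IsLocalMax.comp_onePoint_coe {X : Type*} [TopologicalSpace X] {f : OnePoint X → ℝ} {x : X}
    (h : IsLocalMax f (x : OnePoint X)) : IsLocalMax (fun y : X => f y) x :=
  OnePoint.continuous_coe.continuousAt.eventually h

section Closing

theorem norm_zero_half : ‖((0, 1 / 2) : ℂ × ℝ)‖ < 1 := by
  rw [Prod.norm_def]; norm_num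

theorem norm_half_zero : ‖((1 / 2, 0) : ℂ × ℝ)‖ < 1 := by
  rw [Prod.norm_def]; norm_num

/-- On `‖w‖ = z` the sup norm is the height, and it remains so after inversion and the upward shift.
The second inversion thus inverts the height `(z + 1) / (2z)`. The result increases to `2`, the
height of the image of `∞`, which becomes a cap. -/
theorem dragInfinity_diagonal {z : ℝ} (hz : 1 ≤ z) {w : ℂ} (hw : ‖w‖ = z) :
    ∃ y : ℂ × ℝ, (y : OnePoint (ℂ × ℝ)) = dragInfinity _ norm_zero_half (w, z) ∧
      y.2 = 2 * z / (z + 1) := by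
  have hz0 : 0 < z := by linarith
  have hn : ‖(w, z)‖ = z := by
    rw [Prod.norm_def]; simp [hw, abs_of_pos hz0]
  set y : ℂ × ℝ := ‖(w, z)‖⁻¹ ^ 2 • (w, z) + (1 - ‖(w, z)‖⁻¹) • (0, 1 / 2) with hy
  have hy2 : y.2 = (z + 1) / (2 * z) := by
    simp only [hy, hn, Prod.snd_add, Prod.smul_snd, smul_eq_mul]
    field_simp; ring
  have hy1 : ‖y.1‖ = z⁻¹ := by
    simp only [hy, hn, Prod.fst_add, Prod.smul_fst, smul_zero, add_zero, norm_smul, hw]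
    simp only [norm_pow, norm_inv, Real.norm_eq_abs, abs_of_pos hz0]
    field_simp
  have hyn : ‖y‖ = (z + 1) / (2 * z) := by
    rw [Prod.norm_def, hy1, hy2, Real.norm_eq_abs, abs_of_pos (by positivity), max_eq_right]
    rw [inv_eq_one_div, div_le_div_iff₀ hz0 (by positivity)]
    nlinarith
  have hy0 : y ≠ 0 := by
    rw [← norm_ne_zero_iff, hyn]; positivity
  refine ⟨_, (dragInfinity_of_le_norm norm_zero_half (by rw [hn]; exact hz) hy.symm hy0).symm, ?_⟩
  rw [Prod.smul_snd, hyn, hy2, smul_eq_mul]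
  field_simp

/-- The sideways shift gives a point with coordinates of size `(1 - |z|⁻¹) / 2` and `|z|⁻¹`. The
second dominates up to `|z| = 3`, where the height is unchanged; beyond that the first does, and the
height falls back to `0`. -/
theorem dragInfinity_axis {z : ℝ} (hz : 1 ≤ |z|) :
    ∃ y : ℂ × ℝ, (y : OnePoint (ℂ × ℝ)) = dragInfinity _ norm_half_zero ((0 : ℂ), z) ∧
      y.2 = if |z| ≤ 3 then z else 4 * z / (|z| - 1) ^ 2 := by
  have hz0 : 0 < |z| := by linarith
  have hn : ‖((0 : ℂ), z)‖ = |z| := by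
    rw [Prod.norm_def]; simp
  set y : ℂ × ℝ := ‖((0 : ℂ), z)‖⁻¹ ^ 2 • (0, z) + (1 - ‖((0 : ℂ), z)‖⁻¹) • (1 / 2, 0) with hy
  have hy2 : y.2 = |z|⁻¹ ^ 2 * z := by
    simp only [hy, hn, Prod.snd_add, Prod.smul_snd, smul_eq_mul]
    ring
  have hy2n : ‖y.2‖ = |z|⁻¹ := by
    rw [hy2]; simp only [norm_mul, norm_pow, norm_inv, Real.norm_eq_abs, abs_abs]
    field_simp
  have hy1 : ‖y.1‖ = (1 - |z|⁻¹) / 2 := by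
    simp only [hy, hn, Prod.fst_add, Prod.smul_fst, smul_zero, zero_add, norm_smul]
    rw [Real.norm_eq_abs, abs_of_nonneg (sub_nonneg.2 (inv_le_one_of_one_le₀ hz))]
    norm_num; ring
  have hy0 : y ≠ 0 := by
    intro h
    rw [h] at hy2n
    simp only [Prod.snd_zero, norm_zero] at hy2n
    exact (inv_pos.2 hz0).ne hy2n
  refine ⟨_, (dragInfinity_of_le_norm norm_half_zero (by rw [hn]; exact hz) hy.symm hy0).symm, ?_⟩
  have hcmp : (1 - |z|⁻¹) / 2 ≤ |z|⁻¹ ↔ |z| ≤ 3 := by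
    rw [div_le_iff₀ two_pos, sub_le_iff_le_add]
    have : |z|⁻¹ * 2 + |z|⁻¹ = 3 / |z| := by field_simp; norm_num
    rw [this, le_div_iff₀ hz0, one_mul]
  rw [Prod.smul_snd, Prod.norm_def, hy2n, hy1, smul_eq_mul, hy2]
  split_ifs with h
  · rw [max_eq_right (hcmp.2 h)]
    field_simp
  · rw [max_eq_left (le_of_lt (not_le.1 (mt hcmp.1 h)))]
    have h1 : |z| - 1 ≠ 0 := by push Not at h; linarith
    have h2 : 1 - |z|⁻¹ = (|z| - 1) / |z| := by field_simp
    rw [h2]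
    field_simp
    ring

/-- Closing up a curve whose two ends run diagonally upwards creates a single local maximum. -/
theorem exists_closing_of_diagonal_ends {γ : ℝ → ℂ × ℝ} {T : ℝ}
    (hmid : ∀ t, |t| ≤ T + 1 → ‖γ t‖ ≤ 1) (hend : ∀ t, T ≤ |t| → ‖(γ t).1‖ = (γ t).2)
    (hpos : ∀ t, T ≤ |t| → 0 < (γ t).2)
    (hmono : StrictMonoOn (fun t => (γ t).2) (Set.Ici T))
    (hanti : StrictAntiOn (fun t => (γ t).2) (Set.Iic (-T))) :
    ∃ η : OnePoint ℝ → ℂ × ℝ,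
      (∀ s, (η s : OnePoint (ℂ × ℝ)) = dragInfinity _ norm_zero_half (OnePoint.map γ s)) ∧
      {s | IsLocalMax (fun s => (η s).2) s} ⊆
        (↑) '' {t | IsLocalMax (fun t => (γ t).2) t} ∪ {OnePoint.infty} := by
  -- The new height as a function of the old one on the ends; the two formulas agree at `1`.
  let q : ℝ → ℝ := fun z => if z ≤ 1 then z else 2 * z / (z + 1)
  have hq : StrictMonoOn q (Set.Ioi 0) := by
    intro a ha b hb hab
    simp only [Set.mem_Ioi] at ha hb
    simp only [q]
    split_ifs with h1 h2 h2
    · exact hab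
    · rw [lt_div_iff₀ (by linarith)]; nlinarith
    · linarith
    · rw [div_lt_div_iff₀ (by linarith) (by linarith)]; nlinarith
  have key : ∀ s : OnePoint ℝ, ∃ w : ℂ × ℝ,
      (w : OnePoint (ℂ × ℝ)) = dragInfinity _ norm_zero_half (OnePoint.map γ s) ∧
      ∀ t : ℝ, s = t → (‖γ t‖ ≤ 1 → w.2 = (γ t).2) ∧ (T ≤ |t| → w.2 = q (γ t).2) := by
    intro s
    induction s using OnePoint.rec with
    | infty =>
      refine ⟨_, (dragInfinity_infty norm_zero_half (by simp)).symm, fun t ht => ?_⟩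
      exact absurd ht (OnePoint.infty_ne_coe t)
    | coe t =>
      rw [OnePoint.map_some]
      by_cases h1 : ‖γ t‖ ≤ 1
      · refine ⟨γ t, (dragInfinity_of_norm_le norm_zero_half h1).symm, fun t' ht => ?_⟩
        obtain rfl := OnePoint.coe_injective ht
        refine ⟨fun _ => rfl, fun _ => ?_⟩
        have : (γ t).2 ≤ 1 := (le_abs_self _).trans ((norm_snd_le _).trans h1)
        simp [q, this]
      · have h2 : T ≤ |t| := by
          by_contra hc
          exact h1 (hmid t (by linarith))
        have h3 : 1 < (γ t).2 := by
          push Not at h1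
          rwa [Prod.norm_def, hend t h2, Real.norm_eq_abs, abs_of_pos (hpos t h2), max_self] at h1
        obtain ⟨y, hy, hy2⟩ := dragInfinity_diagonal h3.le (hend t h2)
        refine ⟨y, hy, fun t' ht => ?_⟩
        obtain rfl := OnePoint.coe_injective ht
        refine ⟨fun h => absurd h h1, fun _ => ?_⟩
        simp [q, hy2, h3.not_ge]
  choose η hη hη2 using key
  refine ⟨η, hη, fun s hs => ?_⟩
  induction s using OnePoint.rec with
  | infty => right; rfl
  | coe t =>
    left
    refine ⟨t, ?_, rfl⟩
    have hs' : IsLocalMax (fun x : ℝ => (η x).2) t := IsLocalMax.comp_onePoint_coe hs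
    rcases lt_or_ge |t| (T + 1) with h | h
    · refine hs'.congr ?_
      filter_upwards [(isOpen_lt continuous_abs continuous_const).mem_nhds h] with x hx
      exact ((hη2 x x rfl).1 (hmid x (le_of_lt hx)))
    · exfalso
      rcases le_total 0 t with h0 | h0
      · rw [abs_of_nonneg h0] at h
        refine not_isLocalMax_of_eventually_gt_right ?_ hs'
        filter_upwards [self_mem_nhdsWithin] with x hx
        have hx : t < x := hx
        have h1 : T ≤ |t| := by rw [abs_of_nonneg h0]; linarith
        have h2 : T ≤ |x| := by rw [abs_of_nonneg (by linarith)]; linarith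
        rw [(hη2 t t rfl).2 h1, (hη2 x x rfl).2 h2]
        exact hq (hpos t h1) (hpos x h2)
          (hmono (Set.mem_Ici.2 (by linarith)) (Set.mem_Ici.2 (by linarith)) hx)
      · rw [abs_of_nonpos h0] at h
        refine not_isLocalMax_of_eventually_gt_left ?_ hs'
        filter_upwards [self_mem_nhdsWithin] with x hx
        have hx : x < t := hx
        have h1 : T ≤ |t| := by rw [abs_of_nonpos h0]; linarith
        have h2 : T ≤ |x| := by rw [abs_of_nonpos (by linarith)]; linarith
        rw [(hη2 t t rfl).2 h1, (hη2 x x rfl).2 h2]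
        exact hq (hpos t h1) (hpos x h2)
          (hanti (Set.mem_Iic.2 (by linarith)) (Set.mem_Iic.2 (by linarith)) hx)

/-- Closing up a curve whose two ends run along the vertical axis in opposite directions creates a
single local maximum. -/
theorem exists_closing_of_axis_ends {γ : ℝ → ℂ × ℝ} (hγ : Continuous γ) {T : ℝ} (hT : 0 ≤ T)
    (hmid : ∀ t, |t| ≤ T + 1 → ‖γ t‖ ≤ 1) (hend : ∀ t, T ≤ |t| → (γ t).1 = 0)
    (hpos : ∀ t, T ≤ t → 0 < (γ t).2) (hneg : ∀ t, t ≤ -T → (γ t).2 < 0)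
    (hmono : StrictMonoOn (fun t => (γ t).2) (Set.Ici T))
    (hmono' : StrictMonoOn (fun t => (γ t).2) (Set.Iic (-T))) :
    ∃ (η : OnePoint ℝ → ℂ × ℝ) (t₀ : ℝ),
      (∀ s, (η s : OnePoint (ℂ × ℝ)) = dragInfinity _ norm_half_zero (OnePoint.map γ s)) ∧
      {s | IsLocalMax (fun s => (η s).2) s} ⊆
        (↑) '' {t | IsLocalMax (fun t => (γ t).2) t} ∪ {(t₀ : OnePoint ℝ)} := by
  let q : ℝ → ℝ := fun z => if |z| ≤ 3 then z else 4 * z / (|z| - 1) ^ 2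
  have hq3 : ∀ {a}, |a| ≤ 3 → q a = a := fun h => if_pos h
  have hqpos : ∀ {a}, 0 < a → 0 < q a := by
    intro a ha
    simp only [q]
    split_ifs with h
    · exact ha
    · push Not at h
      have : 0 < |a| - 1 := by linarith
      positivity
  have hqanti : ∀ {a b}, 3 ≤ a → a < b → q b < q a := by
    intro a b ha hab
    have h1 : q a = 4 * a / (a - 1) ^ 2 := by
      simp only [q]
      rw [abs_of_pos (by linarith)]
      split_ifs with h
      · obtain rfl : a = 3 := le_antisymm h ha
        norm_num
      · rfl
    have h2 : q b = 4 * b / (b - 1) ^ 2 := by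
      simp only [q]
      rw [abs_of_pos (by linarith), if_neg (by linarith)]
    rw [h1, h2, div_lt_div_iff₀ (by nlinarith) (by nlinarith)]
    -- `a (b - 1)² - b (a - 1)² = (b - a) (a b - 1)`.
    nlinarith [mul_pos (sub_pos.2 hab) (by nlinarith : 0 < a * b - 1)]
  have hqodd : ∀ a, q (-a) = - q a := by
    intro a
    simp only [q, abs_neg]
    split_ifs <;> ring
  -- Both height formulas hold for `T ≤ |t| ≤ T + 1`; this margin lets an end point be compared with
  -- parameters on either side of it.
  have key : ∀ s : OnePoint ℝ, ∃ w : ℂ × ℝ,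
      (w : OnePoint (ℂ × ℝ)) = dragInfinity _ norm_half_zero (OnePoint.map γ s) ∧
      (s = OnePoint.infty → w.2 = 0) ∧
      ∀ t : ℝ, s = t → (‖γ t‖ ≤ 1 → w.2 = (γ t).2) ∧ (T ≤ |t| → w.2 = q (γ t).2) := by
    intro s
    induction s using OnePoint.rec with
    | infty =>
      refine ⟨_, (dragInfinity_infty norm_half_zero (by simp)).symm, fun _ => ?_, fun t ht => ?_⟩
      · simp
      exact absurd ht (OnePoint.infty_ne_coe t)
    | coe t =>
      rw [OnePoint.map_some]
      by_cases h1 : ‖γ t‖ ≤ 1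
      · refine ⟨γ t, (dragInfinity_of_norm_le norm_half_zero h1).symm,
          fun h => absurd h (OnePoint.coe_ne_infty t), fun t' ht => ?_⟩
        obtain rfl := OnePoint.coe_injective ht
        refine ⟨fun _ => rfl, fun _ => ?_⟩
        have : |(γ t).2| ≤ 1 := (norm_snd_le _).trans h1
        rw [hq3 (by linarith)]
      · have h2 : T ≤ |t| := by
          by_contra hc
          exact h1 (hmid t (by linarith))
        have h4 : γ t = (0, (γ t).2) := Prod.ext (hend t h2) rfl
        have h3 : 1 < |(γ t).2| := by
          push Not at h1
          rw [h4, Prod.norm_def] at h1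
          simpa using h1
        obtain ⟨y, hy, hy2⟩ := dragInfinity_axis h3.le
        rw [← h4] at hy
        refine ⟨y, hy, fun h => absurd h (OnePoint.coe_ne_infty t), fun t' ht => ?_⟩
        obtain rfl := OnePoint.coe_injective ht
        exact ⟨fun h => absurd h h1, fun _ => hy2⟩
  choose η hη hηinf hη2 using key
  have hq1 : ∀ {t : ℝ}, T ≤ |t| → (η t).2 = q (γ t).2 := fun {t} h => (hη2 t t rfl).2 h
  have hT1 : ∀ {t : ℝ}, T ≤ t → T ≤ |t| := fun h => h.trans (le_abs_self _)
  have hT2 : ∀ {t : ℝ}, t ≤ -T → T ≤ |t| := fun h => by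
    rw [abs_of_nonpos (by linarith)]; linarith
  have hcont : Continuous fun t => (γ t).2 := continuous_snd.comp hγ
  -- The upper end turns at height `3`, reached at most once. The value `0` is a dummy in case it is
  -- never reached.
  obtain ⟨t₀, ht₀⟩ : ∃ t₀, ∀ t, T ≤ t → (γ t).2 = 3 → t = t₀ := by
    by_cases h : ∃ t, T ≤ t ∧ (γ t).2 = 3
    · obtain ⟨t₀, h1, h2⟩ := h
      exact ⟨t₀, fun t h3 h4 => hmono.injOn h3 h1 (h4.trans h2.symm)⟩
    · exact ⟨0, fun t h1 h2 => absurd ⟨t, h1, h2⟩ h⟩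
  refine ⟨η, t₀, hη, fun s hs => ?_⟩
  induction s using OnePoint.rec with
  | infty =>
    -- The point `∞` goes to height `0`, with points of the upper end at positive heights
    -- arbitrarily close to it.
    exfalso
    have h1 : Tendsto ((↑) : ℝ → OnePoint ℝ) atTop (𝓝 OnePoint.infty) := by
      refine OnePoint.tendsto_coe_infty.mono_left ?_
      rw [coclosedCompact_eq_cocompact]
      exact atTop_le_cocompact
    obtain ⟨t, h2, h3⟩ := ((h1.eventually hs).and (eventually_ge_atTop T)).exists
    simp only [hηinf _ rfl, hq1 (hT1 h3)] at h2
    exact absurd (hqpos (hpos t h3)) h2.not_gt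
  | coe t =>
    have hs' : IsLocalMax (fun x : ℝ => (η x).2) t := IsLocalMax.comp_onePoint_coe hs
    rcases lt_or_ge |t| (T + 1) with h | h
    · left
      refine ⟨t, ?_, rfl⟩
      refine hs'.congr ?_
      filter_upwards [(isOpen_lt continuous_abs continuous_const).mem_nhds h] with x hx
      exact ((hη2 x x rfl).1 (hmid x (le_of_lt hx)))
    rcases le_total 0 t with h0 | h0
    · rw [abs_of_nonneg h0] at h
      have hTt : T ≤ t := by linarith
      rcases lt_trichotomy (γ t).2 3 with h3 | h3 | h3
      · exfalso
        refine not_isLocalMax_of_eventually_gt_right ?_ hs'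
        filter_upwards [self_mem_nhdsWithin,
          nhdsWithin_le_nhds ((isOpen_lt hcont continuous_const).mem_nhds h3)] with x hx hx3
        have hx : t < x := hx
        have hTx : T ≤ x := by linarith
        have hx3 : (γ x).2 < 3 := hx3
        rw [hq1 (hT1 hTt), hq1 (hT1 hTx), hq3 (by rw [abs_of_pos (hpos t hTt)]; exact h3.le),
          hq3 (by rw [abs_of_pos (hpos x hTx)]; exact hx3.le)]
        exact hmono hTt hTx hx
      · right
        exact congrArg _ (ht₀ t hTt h3)
      · exfalso
        refine not_isLocalMax_of_eventually_gt_left ?_ hs'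
        filter_upwards [self_mem_nhdsWithin,
          nhdsWithin_le_nhds ((isOpen_lt continuous_const hcont).mem_nhds h3),
          nhdsWithin_le_nhds ((isOpen_lt continuous_const continuous_id).mem_nhds
            (by linarith : T < t))] with x hx hx3 hTx
        have hTx : T < x := hTx
        have hx3 : 3 < (γ x).2 := hx3
        rw [hq1 (hT1 hTt), hq1 (hT1 hTx.le)]
        exact hqanti hx3.le (hmono hTx.le hTt hx)
    · exfalso
      rw [abs_of_nonpos h0] at h
      have hTt : t ≤ -T := by linarith
      -- On the lower end `q` turns at `-3`, which is a minimum: one side of every parameter is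
      -- strictly higher.
      rcases le_or_gt (γ t).2 (-3) with h3 | h3
      · refine not_isLocalMax_of_eventually_gt_left ?_ hs'
        filter_upwards [self_mem_nhdsWithin] with x hx
        have hx : x < t := hx
        have hTx : x ≤ -T := by linarith
        have hlt : (γ x).2 < (γ t).2 := hmono' hTx hTt hx
        rw [hq1 (hT2 hTt), hq1 (hT2 hTx), ← neg_neg (γ t).2, ← neg_neg (γ x).2, hqodd,
          hqodd (-(γ x).2)]
        exact neg_lt_neg (hqanti (by linarith) (by linarith))
      · refine not_isLocalMax_of_eventually_gt_right ?_ hs'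
        filter_upwards [self_mem_nhdsWithin,
          nhdsWithin_le_nhds ((isOpen_lt continuous_id continuous_const).mem_nhds
            (by linarith : t < -T))] with x hx hTx
        have hx : t < x := hx
        have hTx : x < -T := hTx
        have hlt : (γ t).2 < (γ x).2 := hmono' hTt hTx.le hx
        rw [hq1 (hT2 hTt), hq1 (hT2 hTx.le),
          hq3 (by rw [abs_of_neg (hneg t hTt)]; linarith),
          hq3 (by rw [abs_of_neg (hneg x hTx.le)]; linarith)]
        exact hlt

end Closing

/-! ### Closing curves with general monotone ends. -/

/-- The curve `γ`, extended by the point at infinity, can be moved into `ℂ × ℝ` by a homeomorphism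
homotopic to the identity so that its height has at most `N` local maxima. -/
def HasClosing (γ : ℝ → ℂ × ℝ) (N : ℕ∞) : Prop :=
  ∃ G : OnePoint (ℂ × ℝ) ≃ₜ OnePoint (ℂ × ℝ), G.HomotopicToId ∧ ∃ η : OnePoint ℝ → ℂ × ℝ,
    (∀ s, (η s : OnePoint (ℂ × ℝ)) = G (OnePoint.map γ s)) ∧
      {s | IsLocalMax (fun s => (η s).2) s}.encard ≤ N

theorem HasClosing.of_comp {γ : ℝ → ℂ × ℝ} {N : ℕ∞} {H : ℂ × ℝ ≃ₜ ℂ × ℝ}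
    (hH : H.onePointCongr.HomotopicToId) (h : HasClosing (H ∘ γ) N) : HasClosing γ N := by
  obtain ⟨G, hG, η, hη, hN⟩ := h
  refine ⟨H.onePointCongr.trans G, hH.trans hG, η, fun s => ?_, hN⟩
  rw [hη s]
  induction s using OnePoint.rec <;> rfl

theorem isLocalMax_const_mul_iff {X : Type*} [TopologicalSpace X] {f : X → ℝ} {x : X} {R : ℝ}
    (hR : 0 < R) : IsLocalMax (fun y => R * f y) x ↔ IsLocalMax f x := by
  simp only [IsLocalMax, IsMaxFilter, mul_le_mul_iff_right₀ hR]

/-- Conjugating by scaling with `R⁻¹` makes the fixed ball as large as needed and does not affect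
local maxima of the height. The exceptional point `p` accounts for the `+ 1`. -/
theorem hasClosing_of_dragInfinity {c : ℂ × ℝ} (hc : ‖c‖ < 1) {γ : ℝ → ℂ × ℝ} {R : ℝ} (hR : 0 < R)
    {η : OnePoint ℝ → ℂ × ℝ} {p : OnePoint ℝ}
    (hη : ∀ s, (η s : OnePoint (ℂ × ℝ)) = dragInfinity c hc (OnePoint.map (fun t => R⁻¹ • γ t) s))
    (hmax : {s | IsLocalMax (fun s => (η s).2) s} ⊆
        (↑) '' {t | IsLocalMax (fun t => (R⁻¹ • γ t).2) t} ∪ {p}) :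
    HasClosing γ ({t | IsLocalMax (fun t => (γ t).2) t}.encard + 1) := by
  let e : OnePoint (ℂ × ℝ) ≃ₜ OnePoint (ℂ × ℝ) :=
    (Homeomorph.smulOfNeZero R⁻¹ (inv_ne_zero hR.ne')).onePointCongr
  refine ⟨(e.trans (dragInfinity c hc)).trans e.symm, (homotopicToId_dragInfinity c hc).conj e,
    fun s => R • η s, fun s => ?_, ?_⟩
  · have h1 : e (OnePoint.map γ s) = OnePoint.map (fun t => R⁻¹ • γ t) s := by
      induction s using OnePoint.rec <;> rfl
    simp only [Homeomorph.trans_apply]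
    rw [h1, ← hη s, Homeomorph.eq_symm_apply]
    change ((R⁻¹ • R • η s : ℂ × ℝ) : OnePoint (ℂ × ℝ)) = _
    rw [inv_smul_smul₀ hR.ne']
  · simp only [Prod.smul_snd, smul_eq_mul, isLocalMax_const_mul_iff hR,
      isLocalMax_const_mul_iff (inv_pos.2 hR)] at hmax ⊢
    refine (Set.encard_le_encard hmax).trans ((Set.encard_union_le _ _).trans ?_)
    rw [Set.encard_singleton]
    gcongr
    exact Set.encard_image_le _ _

/-- A function that is eventually strictly increasing and unbounded has an inverse near infinity. -/
theorem exists_inverse_near_atTop {h : ℝ → ℝ} (hc : Continuous h) {T : ℝ}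
    (hm : StrictMonoOn h (Set.Ici T)) (ht : Tendsto h atTop atTop) :
    ∃ p : C(ℝ, ℝ), (∀ z, T ≤ p z) ∧ (∀ z, h T ≤ z → h (p z) = z) ∧ ∀ t, T ≤ t → p (h t) = t := by
  -- Left of `T`, `h` is replaced by a line of slope one, giving an increasing bijection of `ℝ`; its
  -- inverse, cut off below at `T`, is `p`.
  let H : ℝ → ℝ := fun t => h (max t T) + min (t - T) 0
  have hH1 : ∀ t, T ≤ t → H t = h t := fun t h1 => by
    simp [H, h1]
  have hH2 : ∀ t, t ≤ T → H t = h T + (t - T) := fun t h1 => by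
    simp [H, h1]
  have hHm : StrictMono H := by
    intro a b hab
    rcases le_total T a with h1 | h1
    · rw [hH1 a h1, hH1 b (by linarith)]
      exact hm h1 (Set.mem_Ici.2 (by linarith)) hab
    · rw [hH2 a h1]
      rcases le_or_gt b T with h2 | h2
      · rw [hH2 b h2]; linarith
      · rw [hH1 b h2.le]
        have := hm (Set.mem_Ici.2 le_rfl) h2.le h2
        linarith
  have hHc : Continuous H := by fun_prop
  have hHs : Function.Surjective H := by
    refine hHc.surjective ?_ ?_
    · refine ht.congr' ?_
      filter_upwards [eventually_ge_atTop T] with t h1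
      exact (hH1 t h1).symm
    · have : Tendsto (fun t : ℝ => h T + (t - T)) atBot atBot :=
        tendsto_atBot_add_const_left _ _ (tendsto_atBot_add_const_right _ _ tendsto_id)
      refine this.congr' ?_
      filter_upwards [eventually_le_atBot T] with t h1
      exact (hH2 t h1).symm
  let e := hHm.orderIsoOfSurjective H hHs
  have he : ∀ t, e.symm (H t) = t := fun t => e.symm_apply_apply t
  have he' : ∀ z, H (e.symm z) = z := fun z => e.apply_symm_apply z
  refine ⟨⟨fun z => max (e.symm z) T, e.symm.continuous.max continuous_const⟩,
    fun z => le_max_right _ _, fun z hz => ?_, fun t h1 => ?_⟩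
  · have h2 : T ≤ e.symm z := by
      rw [← he T, hH1 T le_rfl]
      exact e.symm.monotone hz
    simp only [ContinuousMap.coe_mk, max_eq_left h2]
    rw [← hH1 _ h2, he']
  · simp only [ContinuousMap.coe_mk]
    rw [← hH1 t h1, he, max_eq_left h1]

theorem exists_norm_le_of_abs_le {γ : ℝ → ℂ × ℝ} (hγ : Continuous γ) (T : ℝ) :
    ∃ R : ℝ, 0 < R ∧ ∀ t, |t| ≤ T → ‖R⁻¹ • γ t‖ ≤ 1 := by
  obtain ⟨C, hC⟩ := (isCompact_Icc (a := -T) (b := T)).exists_bound_of_continuousOn hγ.continuousOn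
  refine ⟨max C 1, by positivity, fun t ht => ?_⟩
  have h0 : 0 < max C 1 := by positivity
  rw [norm_smul, norm_inv, Real.norm_of_nonneg h0.le, inv_mul_le_iff₀ h0, mul_one]
  exact (hC t (abs_le.1 ht)).trans (le_max_left _ _)

/-- A curve whose ends both go up monotonically can be closed by adding one local maximum. -/
theorem hasClosing_of_ends_up {γ : ℝ → ℂ × ℝ} (hγ : Continuous γ) (hinj : Function.Injective γ)
    {T : ℝ} (hT : 0 < T) (hmono : StrictMonoOn (fun t => (γ t).2) (Set.Ici T))
    (hanti : StrictAntiOn (fun t => (γ t).2) (Set.Iic (-T)))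
    (htop : Tendsto (fun t => (γ t).2) atTop atTop)
    (hbot : Tendsto (fun t => (γ t).2) atBot atTop) :
    HasClosing γ ({t | IsLocalMax (fun t => (γ t).2) t}.encard + 1) := by
  have hc : Continuous fun t => (γ t).2 := continuous_snd.comp hγ
  obtain ⟨p, hpT, hp1, hp2⟩ := exists_inverse_near_atTop hc hmono htop
  obtain ⟨n, hnT, hn1, hn2⟩ := exists_inverse_near_atTop (h := fun t => (γ (-t)).2)
    (hc.comp continuous_neg) (T := T)
    (fun a ha b hb hab => hanti (Set.mem_Iic.2 (neg_le_neg hb)) (Set.mem_Iic.2 (neg_le_neg ha)) (neg_lt_neg hab))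
    (hbot.comp tendsto_neg_atTop_atBot)
  set Z : ℝ := max (max (γ T).2 (γ (-T)).2) 1 with hZ
  have hZ1 : (γ T).2 ≤ Z := (le_max_left _ _).trans (le_max_left _ _)
  have hZ2 : (γ (-T)).2 ≤ Z := (le_max_right _ _).trans (le_max_left _ _)
  have hZ3 : 1 ≤ Z := le_max_right _ _
  -- Half the difference of the two ends at equal height, nonzero by injectivity. With `m` their
  -- midpoint and `u = z / δ`, they go to `±z` at large height `z`. Clamping at `Z ≥ 1` keeps `δ`
  -- and `u` defined and nonzero everywhere.
  let δ : ℝ → ℂ := fun z => ((γ (p (max z Z))).1 - (γ (-n (max z Z))).1) / 2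
  have hδ : ∀ z, δ z ≠ 0 := by
    intro z h0
    have h1 : (γ (p (max z Z))).1 = (γ (-n (max z Z))).1 := by
      simpa [δ, sub_eq_zero] using h0
    have h2 : (γ (p (max z Z))).2 = (γ (-n (max z Z))).2 :=
      (hp1 _ (hZ1.trans (le_max_right _ _))).trans (hn1 _ (hZ2.trans (le_max_right _ _))).symm
    have h3 := hinj (Prod.ext h1 h2)
    linarith [hpT (max z Z), hnT (max z Z)]
  have hδc : Continuous δ := by fun_prop
  let m : C(ℝ, ℂ) := ⟨fun z => ((γ (p (max z Z))).1 + (γ (-n (max z Z))).1) / 2, by fun_prop⟩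
  let u : C(ℝ, ℂ) := ⟨fun z => ((max z Z : ℝ) : ℂ) / δ z,
    Continuous.div (by fun_prop) hδc hδ⟩
  have hu : ∀ z, u z ≠ 0 := by
    intro z
    have : 0 < max z Z := lt_of_lt_of_le (by linarith) (le_max_right _ _)
    exact div_ne_zero (by exact_mod_cast this.ne') (hδ z)
  obtain ⟨T₁, hT₁, hZt⟩ : ∃ T₁, T ≤ T₁ ∧ ∀ t, T₁ ≤ |t| → Z ≤ (γ t).2 := by
    obtain ⟨a, ha⟩ := eventually_atTop.1 (htop.eventually_ge_atTop Z)
    obtain ⟨b, hb⟩ := eventually_atBot.1 (hbot.eventually_ge_atTop Z)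
    refine ⟨max T (max a (-b)), le_max_left _ _, fun t ht => ?_⟩
    have h1 : a ≤ |t| := (le_max_left _ _).trans ((le_max_right _ _).trans ht)
    have h2 : -b ≤ |t| := (le_max_right _ _).trans ((le_max_right _ _).trans ht)
    rcases abs_cases t with ⟨h3, -⟩ | ⟨h3, -⟩
    · exact ha t (by linarith)
    · exact hb t (by linarith)
  refine HasClosing.of_comp (homotopicToId_sliceAffine m u hu) ?_
  set γ₁ : ℝ → ℂ × ℝ := sliceAffine m u hu ∘ γ with hγ₁
  have hsnd : ∀ t, (γ₁ t).2 = (γ t).2 := fun t => rfl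
  have hfst : ∀ t, T₁ ≤ |t| → ‖(γ₁ t).1‖ = (γ t).2 := by
    intro t ht
    have hz := hZt t ht
    have hz0 : 0 < (γ t).2 := by linarith
    have h1 : max (γ t).2 Z = (γ t).2 := max_eq_left hz
    have h2 : (γ₁ t).1 = (((γ t).2 : ℝ) : ℂ) / δ (γ t).2 * ((γ t).1 - m (γ t).2) := by
      simp only [hγ₁, Function.comp_apply, sliceAffine_apply, u, ContinuousMap.coe_mk, h1]
    have h3 : (γ t).1 - m (γ t).2 = δ (γ t).2 ∨ (γ t).1 - m (γ t).2 = -δ (γ t).2 := by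
      rcases abs_cases t with ⟨h4, -⟩ | ⟨h4, -⟩
      · left
        have h5 : p (γ t).2 = t := hp2 t (by linarith)
        simp only [m, δ, ContinuousMap.coe_mk, h1, h5]
        ring
      · right
        have h5 : n (γ t).2 = -t := by
          have := hn2 (-t) (by linarith)
          simpa only [neg_neg] using this
        simp only [m, δ, ContinuousMap.coe_mk, h1, h5, neg_neg]
        ring
    have h6 := norm_ne_zero_iff.2 (hδ (γ t).2)
    rw [h2, norm_mul, norm_div, Complex.norm_real, Real.norm_of_nonneg hz0.le]
    rcases h3 with h3 | h3
    · rw [h3]; field_simp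
    · rw [h3, norm_neg]; field_simp
  obtain ⟨R, hR, hRle⟩ := exists_norm_le_of_abs_le
    ((sliceAffine m u hu).continuous.comp hγ) (T₁ + 1)
  have hR' : 0 < R⁻¹ := inv_pos.2 hR
  have hval : ∀ t, (R⁻¹ • γ₁ t).2 = R⁻¹ * (γ t).2 := fun t => rfl
  obtain ⟨η, hη, hmax⟩ := exists_closing_of_diagonal_ends (γ := fun t => R⁻¹ • γ₁ t) (T := T₁) hRle
    (fun t ht => by
      rw [hval, ← hfst t ht, Prod.smul_fst, norm_smul, Real.norm_of_nonneg hR'.le])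
    (fun t ht => by
      rw [hval]
      have := hZt t ht
      exact mul_pos hR' (by linarith))
    (fun a ha b hb hab => by
      simp only [hval]
      exact mul_lt_mul_of_pos_left (hmono (hT₁.trans ha) (hT₁.trans hb) hab) hR')
    (fun a ha b hb hab => by
      simp only [hval]
      exact mul_lt_mul_of_pos_left (hanti (le_trans ha (neg_le_neg hT₁))
        (le_trans hb (neg_le_neg hT₁)) hab) hR')
  exact hasClosing_of_dragInfinity norm_zero_half hR hη hmax

/-- A curve that comes monotonically from below and leaves monotonically upwards can be closed by
adding one local maximum. -/
theorem hasClosing_of_ends_opposite {γ : ℝ → ℂ × ℝ} (hγ : Continuous γ)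
    {T : ℝ} (hT : 0 < T) (hmono : StrictMonoOn (fun t => (γ t).2) (Set.Ici T))
    (hmono' : StrictMonoOn (fun t => (γ t).2) (Set.Iic (-T)))
    (htop : Tendsto (fun t => (γ t).2) atTop atTop)
    (hbot : Tendsto (fun t => (γ t).2) atBot atBot) :
    HasClosing γ ({t | IsLocalMax (fun t => (γ t).2) t}.encard + 1) := by
  have hc : Continuous fun t => (γ t).2 := continuous_snd.comp hγ
  obtain ⟨p, -, -, hp2⟩ := exists_inverse_near_atTop hc hmono htop
  obtain ⟨n, -, -, hn2⟩ := exists_inverse_near_atTop (h := fun t => -(γ (-t)).2)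
    (hc.comp continuous_neg).neg (T := T)
    (fun a ha b hb hab => neg_lt_neg (hmono' (Set.mem_Iic.2 (neg_le_neg hb))
      (Set.mem_Iic.2 (neg_le_neg ha)) (neg_lt_neg hab)))
    (tendsto_neg_atBot_atTop.comp (hbot.comp tendsto_neg_atTop_atBot))
  -- A cutoff choosing the upper end for `z ≥ 1` and the lower end for `z ≤ 0`. Between them the
  -- parameters are interpolated, so subtracting `m` puts both far ends on the axis.
  let l : ℝ → ℝ := fun z => max 0 (min 1 z)
  have hl : Continuous l := by fun_prop
  let m : C(ℝ, ℂ) := ⟨fun z => (γ (l z * p z + (1 - l z) * (-n (-z)))).1, by fun_prop⟩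
  obtain ⟨T₁, hT₁, hup, hdown⟩ : ∃ T₁, T ≤ T₁ ∧ (∀ t, T₁ ≤ t → 1 ≤ (γ t).2) ∧
      ∀ t, t ≤ -T₁ → (γ t).2 ≤ -1 := by
    obtain ⟨a, ha⟩ := eventually_atTop.1 (htop.eventually_ge_atTop 1)
    obtain ⟨b, hb⟩ := eventually_atBot.1 (hbot.eventually_le_atBot (-1))
    have h1 : a ≤ max T (max a (-b)) := (le_max_left _ _).trans (le_max_right _ _)
    have h2 : -b ≤ max T (max a (-b)) := (le_max_right _ _).trans (le_max_right _ _)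
    exact ⟨max T (max a (-b)), le_max_left _ _, fun t ht => ha t (by linarith),
      fun t ht => hb t (by linarith)⟩
  refine HasClosing.of_comp (homotopicToId_sliceAffine m 1 fun _ => one_ne_zero) ?_
  set γ₁ : ℝ → ℂ × ℝ := sliceAffine m 1 (fun _ => one_ne_zero) ∘ γ with hγ₁
  have hc₁ : Continuous γ₁ := (Homeomorph.continuous _).comp hγ
  have hfst : ∀ t, T₁ ≤ |t| → (γ₁ t).1 = 0 := by
    intro t ht
    have h2 : (γ₁ t).1 = 1 * ((γ t).1 - m (γ t).2) := rfl
    have h3 : m (γ t).2 = (γ t).1 := by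
      rcases abs_cases t with ⟨h4, -⟩ | ⟨h4, -⟩
      · have h5 : p (γ t).2 = t := hp2 t (by linarith)
        have h6 : l (γ t).2 = 1 := by
          simp [l, hup t (by linarith)]
        simp [m, h5, h6]
      · have h5 : n (-(γ t).2) = -t := by
          have := hn2 (-t) (by linarith)
          simpa only [neg_neg] using this
        have h6 : l (γ t).2 = 0 := by
          have := hdown t (by linarith)
          simp only [l]
          exact max_eq_left ((min_le_right _ _).trans (by linarith))
        simp [m, h5, h6]
    rw [h2, h3, sub_self, mul_zero]
  obtain ⟨R, hR, hRle⟩ := exists_norm_le_of_abs_le hc₁ (T₁ + 1)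
  have hR' : 0 < R⁻¹ := inv_pos.2 hR
  have hval : ∀ t, (R⁻¹ • γ₁ t).2 = R⁻¹ * (γ t).2 := fun t => rfl
  obtain ⟨η, t₀, hη, hmax⟩ := exists_closing_of_axis_ends (γ := fun t => R⁻¹ • γ₁ t)
    (by fun_prop) (T := T₁) (by linarith) hRle
    (fun t ht => by rw [Prod.smul_fst, hfst t ht, smul_zero])
    (fun t ht => by
      rw [hval]
      have := hup t ht
      exact mul_pos hR' (by linarith))
    (fun t ht => by
      rw [hval]
      have := hdown t ht
      exact mul_neg_of_pos_of_neg hR' (by linarith))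
    (fun a ha b hb hab => by
      simp only [hval]
      exact mul_lt_mul_of_pos_left (hmono (hT₁.trans ha) (hT₁.trans hb) hab) hR')
    (fun a ha b hb hab => by
      simp only [hval]
      exact mul_lt_mul_of_pos_left (hmono' (le_trans ha (neg_le_neg hT₁))
        (le_trans hb (neg_le_neg hT₁)) hab) hR')
  exact hasClosing_of_dragInfinity norm_half_zero hR hη hmax

/-- A properly embedded planar line is unknotted. -/
theorem hasClosing_of_planar {γ : ℝ → ℂ × ℝ} (hγ : IsClosedEmbedding γ) {a : ℝ}
    (ha : ∀ t, (γ t).2 = a) : HasClosing γ 1 := by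
  have h1 : IsClosedEmbedding fun t => (γ t).1 := by
    have hcl : IsClosedEmbedding fun w : ℂ => (w, a) := by
      refine ⟨isEmbedding_prodMkLeft a, ?_⟩
      have : Set.range (fun w : ℂ => (w, a)) = Prod.snd ⁻¹' {a} := by
        ext ⟨w, b⟩; simp [eq_comm]
      rw [this]
      exact isClosed_singleton.preimage continuous_snd
    have h2 : (fun w : ℂ => (w, a)) ∘ (fun t => (γ t).1) = γ := by
      funext t; exact Prod.ext rfl (ha t).symm
    exact (hcl.of_comp_iff).1 (by rw [h2]; exact hγ)
  -- By Tietze, the inverse of the closed planar line extends to `ℂ`; shearing by it makes the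
  -- height `a + t`.
  obtain ⟨F, hF⟩ := ContinuousMap.exists_extension h1 (ContinuousMap.id ℝ)
  have hF' : ∀ t, F (γ t).1 = t := fun t => DFunLike.congr_fun hF t
  refine HasClosing.of_comp (homotopicToId_verticalShear F) ?_
  have h2 : ∀ t, ((verticalShear F ∘ γ) t).2 = a + t := fun t => by
    simp [verticalShear_apply, ha, hF']
  have hm : StrictMono fun t => ((verticalShear F ∘ γ) t).2 := fun x y hxy => by
    simp only [h2]; linarith
  have h3 := hasClosing_of_ends_opposite ((verticalShear F).continuous.comp hγ.continuous)
    one_pos (hm.strictMonoOn _) (hm.strictMonoOn _)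
    (by simp only [h2]; exact tendsto_atTop_add_const_left _ _ tendsto_id)
    (by simp only [h2]; exact tendsto_atBot_add_const_left _ _ tendsto_id)
  have h4 : {t | IsLocalMax (fun t => ((verticalShear F ∘ γ) t).2) t} = ∅ := by
    refine Set.eq_empty_of_forall_notMem fun t ht => ?_
    refine not_isLocalMax_of_eventually_gt_right ?_ ht
    filter_upwards [self_mem_nhdsWithin] with x hx using hm hx
  rwa [h4, Set.encard_empty, zero_add] at h3

/-! ### Local maxima and ends of a polynomial height. -/

theorem Polynomial.eventually_eval_ne {P : ℝ[X]} (hP : 0 < P.natDegree) (a s : ℝ) :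
    ∀ᶠ x in 𝓝[≠] s, P.eval x ≠ a := by
  have h0 : P - C a ≠ 0 := by
    intro h
    rw [sub_eq_zero.1 h, natDegree_C] at hP
    exact lt_irrefl _ hP
  have h1 : {x | P.eval x = a}.Finite := by
    refine (finite_setOfPred_isRoot h0).subset fun x hx => ?_
    have hx : P.eval x = a := hx
    simp [IsRoot, hx]
  exact (nhdsNE_le_cofinite s) h1.compl_mem_cofinite

/-- To the right of a local maximum of a polynomial, there is a critical point before any given
point that is another local maximum or has a larger value. -/
theorem Polynomial.exists_critical_between {P : ℝ[X]} (hP : 0 < P.natDegree) {s u : ℝ} (hsu : s < u)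
    (hs : IsLocalMax (fun t => P.eval t) s)
    (hu : IsLocalMax (fun t => P.eval t) u ∨ P.eval s < P.eval u) :
    ∃ c ∈ Set.Ioo s u, P.derivative.eval c = 0 := by
  -- The minimum on `[s, u]` is interior: a nonconstant polynomial is strictly smaller near a local
  -- maximum, and in the other case `P s < P u`.
  obtain ⟨c, hc, hmin⟩ := isCompact_Icc.exists_isMinOn (Set.nonempty_Icc.2 hsu.le)
    (P.continuous.continuousOn (s := Set.Icc s u))
  have hmin' : ∀ x ∈ Set.Icc s u, P.eval c ≤ P.eval x := fun x hx => hmin hx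
  have hcs : c ≠ s := by
    rintro rfl
    have h1 : ∀ᶠ x in 𝓝[>] c, P.eval x ≤ P.eval c := hs.filter_mono nhdsWithin_le_nhds
    have h2 : ∀ᶠ x in 𝓝[>] c, P.eval x ≠ P.eval c :=
      (P.eventually_eval_ne hP _ _).filter_mono (nhdsWithin_mono _ fun x hx => ne_of_gt hx)
    obtain ⟨x, h3, h4, h5⟩ := (h1.and (h2.and (Ioo_mem_nhdsGT hsu))).exists
    exact h4 (le_antisymm h3 (hmin' x ⟨h5.1.le, h5.2.le⟩))
  have hcu : c ≠ u := by
    rintro rfl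
    rcases hu with hu | hu
    · have h1 : ∀ᶠ x in 𝓝[<] c, P.eval x ≤ P.eval c := hu.filter_mono nhdsWithin_le_nhds
      have h2 : ∀ᶠ x in 𝓝[<] c, P.eval x ≠ P.eval c :=
        (P.eventually_eval_ne hP _ _).filter_mono (nhdsWithin_mono _ fun x hx => ne_of_lt hx)
      obtain ⟨x, h3, h4, h5⟩ := (h1.and (h2.and (Ioo_mem_nhdsLT hsu))).exists
      exact h4 (le_antisymm h3 (hmin' x ⟨h5.1.le, h5.2.le⟩))
    · exact absurd (hmin' s ⟨le_rfl, hsu.le⟩) hu.not_ge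
  have hc' : c ∈ Set.Ioo s u := ⟨lt_of_le_of_ne hc.1 hcs.symm, lt_of_le_of_ne hc.2 hcu⟩
  refine ⟨c, hc', ?_⟩
  have h1 : IsLocalMin (fun t => P.eval t) c := hmin.isLocalMin (Icc_mem_nhds hc'.1 hc'.2)
  simpa using h1.deriv_eq_zero

/-- Each local maximum is paired with a critical point to its right, before the next local maximum;
for the last one, growth at `+∞` supplies it. All these roots of `P'` are distinct. -/
theorem Polynomial.encard_isLocalMax_le {P : ℝ[X]} (hP : 0 < P.natDegree)
    (htop : Tendsto (fun t => P.eval t) atTop atTop) :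
    ∃ m : ℕ, {t | IsLocalMax (fun t => P.eval t) t}.encard = m ∧ 2 * m + 1 ≤ P.natDegree := by
  have hd : P.derivative ≠ 0 := by
    intro h
    exact hP.ne' (derivative_eq_zero.1 h)
  have hcrit : ∀ t, IsLocalMax (fun t => P.eval t) t → P.derivative.eval t = 0 := fun t ht => by
    simpa using ht.deriv_eq_zero
  have hfin : {t | IsLocalMax (fun t => P.eval t) t}.Finite :=
    (finite_setOfPred_isRoot hd).subset fun t ht => hcrit t ht
  obtain ⟨S, hS⟩ : ∃ S : Finset ℝ, ∀ t, t ∈ S ↔ IsLocalMax (fun t => P.eval t) t :=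
    ⟨hfin.toFinset, fun t => by simp⟩
  have hnext : ∀ s ∈ S, ∃ c, s < c ∧ P.derivative.eval c = 0 ∧ c ∉ S ∧ ∀ s' ∈ S, s < s' → c < s' := by
    intro s hs
    by_cases hne : (S.filter (s < ·)).Nonempty
    · obtain ⟨u, hu, hmin⟩ := (S.filter (s < ·)).exists_min_image id hne
      rw [Finset.mem_filter] at hu
      obtain ⟨c, hc, hc0⟩ := P.exists_critical_between hP hu.2 ((hS s).1 hs) (.inl ((hS u).1 hu.1))
      refine ⟨c, hc.1, hc0, fun hcS => ?_, fun s' hs' hlt => ?_⟩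
      · exact absurd (hmin c (Finset.mem_filter.2 ⟨hcS, hc.1⟩)) (not_le.2 hc.2)
      · exact hc.2.trans_le (hmin s' (Finset.mem_filter.2 ⟨hs', hlt⟩))
    · have hno : ∀ s' ∈ S, ¬ s < s' := fun s' hs' hlt =>
        hne ⟨s', Finset.mem_filter.2 ⟨hs', hlt⟩⟩
      obtain ⟨u, hu, hsu⟩ :=
        ((htop.eventually_gt_atTop (P.eval s)).and (eventually_gt_atTop s)).exists
      obtain ⟨c, hc, hc0⟩ := P.exists_critical_between hP hsu ((hS s).1 hs) (.inr hu)
      exact ⟨c, hc.1, hc0, fun hcS => hno c hcS hc.1, fun s' hs' hlt => absurd hlt (hno s' hs')⟩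
  choose! c hc1 hc2 hc3 hc4 using hnext
  have hinj : Set.InjOn c S := by
    intro a ha b hb hab
    rcases lt_trichotomy a b with h | h | h
    · have := (hc4 a ha b hb h).trans (hc1 b hb)
      exact absurd hab this.ne
    · exact h
    · have := (hc4 b hb a ha h).trans (hc1 a ha)
      exact absurd hab this.ne'
  have hdisj : Disjoint S (S.image c) := by
    rw [Finset.disjoint_right]
    intro x hx
    obtain ⟨s, hs, rfl⟩ := Finset.mem_image.1 hx
    exact hc3 s hs
  have hsub : S ∪ S.image c ⊆ P.derivative.roots.toFinset := by
    intro x hx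
    rw [Multiset.mem_toFinset, mem_roots hd, IsRoot]
    rcases Finset.mem_union.1 hx with hx | hx
    · exact hcrit x ((hS x).1 hx)
    · obtain ⟨s, hs, rfl⟩ := Finset.mem_image.1 hx
      exact hc2 s hs
  refine ⟨S.card, ?_, ?_⟩
  · rw [← Set.encard_coe_eq_coe_finsetCard]
    congr 1
    ext t
    exact (hS t).symm
  · have h1 := Finset.card_le_card hsub
    rw [Finset.card_union_of_disjoint hdisj, Finset.card_image_of_injOn hinj] at h1
    have h2 := (Multiset.toFinset_card_le P.derivative.roots).trans (card_roots' _)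
    have h3 := natDegree_derivative_lt hP.ne'
    omega

theorem Polynomial.tendsto_atTop_of_leadingCoeff_pos {P : ℝ[X]} (hP : 0 < P.natDegree)
    (hl : 0 < P.leadingCoeff) : Tendsto (fun t => P.eval t) atTop atTop :=
  P.tendsto_atTop_of_leadingCoeff_nonneg (natDegree_pos_iff_degree_pos.1 hP) hl.le

theorem Polynomial.exists_strictMonoOn_Ici {P : ℝ[X]} (hP : 0 < P.natDegree)
    (hl : 0 < P.leadingCoeff) : ∃ T₀ : ℝ, StrictMonoOn (fun t => P.eval t) (Set.Ici T₀) := by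
  have hl' : 0 < P.derivative.leadingCoeff := by
    rw [leadingCoeff_derivative]
    positivity
  have hev : ∀ᶠ t in atTop, 0 < P.derivative.eval t := by
    rcases Nat.eq_zero_or_pos P.derivative.natDegree with h | h
    · rw [eq_C_of_natDegree_eq_zero h]
      rw [leadingCoeff, h] at hl'
      simp [hl']
    · exact (P.derivative.tendsto_atTop_of_leadingCoeff_pos h hl').eventually_gt_atTop 0
  obtain ⟨T₀, hT₀⟩ := eventually_atTop.1 hev
  refine ⟨T₀, strictMonoOn_of_deriv_pos (convex_Ici T₀) P.continuous.continuousOn fun t ht => ?_⟩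
  rw [interior_Ici] at ht
  simpa using hT₀ t (le_of_lt ht)

/-- A curve with nonconstant polynomial height of positive leading coefficient can be closed. -/
theorem hasClosing_of_polynomial_height {γ : ℝ → ℂ × ℝ} (hγ : Continuous γ)
    (hinj : Function.Injective γ) {P : ℝ[X]} (hγP : ∀ t, (γ t).2 = P.eval t)
    (hP : 0 < P.natDegree) (hl : 0 < P.leadingCoeff) :
    HasClosing γ ({t | IsLocalMax (fun t => P.eval t) t}.encard + 1) := by
  have htop := P.tendsto_atTop_of_leadingCoeff_pos hP hl
  obtain ⟨T₁, hT₁⟩ := P.exists_strictMonoOn_Ici hP hl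
  -- `Q` carries the left end to the right; the parity of the degree decides whether that end goes
  -- up or down.
  set Q : ℝ[X] := P.comp (-X) with hQ
  have hQe : ∀ t, Q.eval t = P.eval (-t) := fun t => by simp [hQ]
  have hQn : Q.natDegree = P.natDegree := by simp [hQ, natDegree_comp]
  have hQl : Q.leadingCoeff = P.leadingCoeff * (-1) ^ P.natDegree := by
    rw [hQ, leadingCoeff_comp (by simp)]; simp
  simp only [← hγP] at htop hT₁ ⊢
  rcases Nat.even_or_odd P.natDegree with he | he
  · have hQl' : 0 < Q.leadingCoeff := by rw [hQl, he.neg_one_pow, mul_one]; exact hl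
    have hQtop := Q.tendsto_atTop_of_leadingCoeff_pos (by omega) hQl'
    obtain ⟨T₂, hT₂⟩ := Q.exists_strictMonoOn_Ici (by omega) hQl'
    have h1 : T₁ ≤ max 1 (max T₁ T₂) := (le_max_left _ _).trans (le_max_right _ _)
    have h2 : T₂ ≤ max 1 (max T₁ T₂) := (le_max_right _ _).trans (le_max_right _ _)
    refine hasClosing_of_ends_up hγ hinj (T := max 1 (max T₁ T₂)) (by positivity)
      (hT₁.mono (Set.Ici_subset_Ici.2 h1)) (fun a ha b hb hab => ?_) htop ?_
    · have ha : a ≤ _ := ha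
      have hb : b ≤ _ := hb
      have := hT₂ (Set.mem_Ici.2 (by linarith : T₂ ≤ -b)) (Set.mem_Ici.2 (by linarith : T₂ ≤ -a))
        (neg_lt_neg hab)
      simpa only [hQe, neg_neg, ← hγP] using this
    · refine (hQtop.comp tendsto_neg_atBot_atTop).congr fun t => ?_
      simp [hQe, hγP]
  · have hQn' : (-Q).natDegree = P.natDegree := by rw [natDegree_neg, hQn]
    have hQl' : 0 < (-Q).leadingCoeff := by
      rw [leadingCoeff_neg, hQl, he.neg_one_pow]; linarith
    have hQtop := (-Q).tendsto_atTop_of_leadingCoeff_pos (by omega) hQl'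
    obtain ⟨T₂, hT₂⟩ := (-Q).exists_strictMonoOn_Ici (by omega) hQl'
    have h1 : T₁ ≤ max 1 (max T₁ T₂) := (le_max_left _ _).trans (le_max_right _ _)
    have h2 : T₂ ≤ max 1 (max T₁ T₂) := (le_max_right _ _).trans (le_max_right _ _)
    refine hasClosing_of_ends_opposite hγ (T := max 1 (max T₁ T₂)) (by positivity)
      (hT₁.mono (Set.Ici_subset_Ici.2 h1)) (fun a ha b hb hab => ?_) htop ?_
    · have ha : a ≤ _ := ha
      have hb : b ≤ _ := hb
      have := hT₂ (Set.mem_Ici.2 (by linarith : T₂ ≤ -b)) (Set.mem_Ici.2 (by linarith : T₂ ≤ -a))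
        (neg_lt_neg hab)
      simpa only [eval_neg, hQe, neg_neg, ← hγP, neg_lt_neg_iff] using this
    · refine (tendsto_neg_atTop_atBot.comp (hQtop.comp tendsto_neg_atBot_atTop)).congr fun t => ?_
      simp [hQe, hγP]

/-! ### From heights to the bridge number. -/

/-- Coordinates on three-space with a prescribed height function. -/
theorem exists_equiv_snd_eq_inner {v : EucSpace 3} (hv : v ≠ 0) :
    ∃ L : EucSpace 3 ≃L[ℝ] ℂ × ℝ, ∀ x, (L x).2 = inner ℝ v x := by
  have : Fact (Module.finrank ℝ (EucSpace 3) = 2 + 1) := ⟨by simp⟩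
  have hfr : Module.finrank ℝ (ℝ ∙ v)ᗮ = Module.finrank ℝ ℂ := by
    rw [Submodule.finrank_orthogonal_span_singleton (n := 2) hv, Complex.finrank_real_complex]
  let e : (ℝ ∙ v)ᗮ ≃ₗ[ℝ] ℂ := LinearEquiv.ofFinrankEq _ _ hfr
  let f : EucSpace 3 →ₗ[ℝ] ℂ × ℝ :=
    (e.toLinearMap ∘ₗ ((ℝ ∙ v)ᗮ.orthogonalProjectionOnto : EucSpace 3 →ₗ[ℝ] (ℝ ∙ v)ᗮ)).prod
      (innerSL ℝ v : EucSpace 3 →ₗ[ℝ] ℝ)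
  have hf : Function.Injective f := by
    rw [injective_iff_map_eq_zero]
    intro x hx
    have h1 : e ((ℝ ∙ v)ᗮ.orthogonalProjectionOnto x) = 0 := congrArg Prod.fst hx
    have h2 : inner ℝ v x = 0 := congrArg Prod.snd hx
    have h3 : x ∈ (ℝ ∙ v)ᗮ := Submodule.mem_orthogonal_singleton_iff_inner_right.2 h2
    rw [LinearEquiv.map_eq_zero_iff] at h1
    have h4 := Submodule.starProjection_eq_self_iff.2 h3
    rw [Submodule.starProjection_apply, h1] at h4
    simpa using h4.symm
  have hdim : Module.finrank ℝ (EucSpace 3) = Module.finrank ℝ (ℂ × ℝ) := by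
    simp [Complex.finrank_real_complex]
  refine ⟨(LinearEquiv.ofInjectiveOfFinrankEq f hf hdim).toContinuousLinearEquiv, fun x => ?_⟩
  rfl

theorem PolyKnot.isClosedEmbedding {n : ℕ} (κ : PolyKnot n) :
    IsClosedEmbedding (polyCurve κ.comp) :=
  .of_continuous_injective_isClosedMap κ.isEmbedding.continuous κ.isEmbedding.injective
    (isProperMap_iff_tendsto_cocompact.2
      ⟨κ.isEmbedding.continuous, κ.tendsto_cocompact⟩).isClosedMap

theorem isOrientationPreserving_refl (n : ℕ) (X : Type) [TopologicalSpace X] :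
    IsOrientationPreserving n (Homeomorph.refl X) :=
  isOrientationPreserving_of_homotopic n (ContinuousMap.Homotopic.refl _)

/-- Conjugating the closing map by `L` keeps it homotopic to the identity, so it does not matter
whether `L` preserves orientation. The circle is not reparametrized. -/
theorem PolyKnot.bridgeNumber_le_of_hasClosing (κ : PolyKnot 3) {v : EucSpace 3} (hv : v ≠ 0)
    {L : EucSpace 3 ≃L[ℝ] ℂ × ℝ} (hL : ∀ x, (L x).2 = inner ℝ v x) {N : ℕ∞}
    (h : HasClosing (L ∘ polyCurve κ.comp) N) : κ.completion.bridgeNumber ≤ N := by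
  obtain ⟨G, hG, η, hη, hN⟩ := h
  let e : SphereOf 3 ≃ₜ OnePoint (ℂ × ℝ) := L.toHomeomorph.onePointCongr
  let g : SphereOf 3 ≃ₜ SphereOf 3 := (e.trans G).trans e.symm
  have hg : ∀ s, ((L.symm (η s) : EucSpace 3) : SphereOf 3) = g (κ.completion.toFun s) := by
    intro s
    have h1 : e (κ.completion.toFun s) = OnePoint.map (L ∘ polyCurve κ.comp) s := by
      induction s using OnePoint.rec <;> rfl
    simp only [g, Homeomorph.trans_apply]
    rw [h1, ← hη s, Homeomorph.eq_symm_apply]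
    change ((L (L.symm (η s)) : ℂ × ℝ) : OnePoint (ℂ × ℝ)) = _
    rw [L.apply_symm_apply]
  let K' : SpaceKnot 3 :=
    { toFun := fun s => L.symm (η s)
      isEmbedding := by
        rw [← (OnePoint.isOpenEmbedding_coe (X := EucSpace 3)).isEmbedding.of_comp_iff]
        have : ((↑) : EucSpace 3 → SphereOf 3) ∘ (fun s => L.symm (η s))
            = g ∘ κ.completion.toFun := funext hg
        rw [this]
        exact g.isEmbedding.comp κ.completion.isEmbedding }
  have hK : K'.toTopKnot.Equivalent κ.completion :=
    ⟨Homeomorph.refl _, g, isOrientationPreserving_refl 1 _,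
      isOrientationPreserving_of_homotopic 3 (hG.conj e), funext hg⟩
  refine (iInf₂_le_of_le K' hK (iInf₂_le_of_le v hv ?_))
  have h2 : ∀ s, inner ℝ v (K'.toFun s) = (η s).2 := fun s => by
    rw [← hL]; simp [K']
  simpa only [SpaceKnot.numLocalMax, h2] using hN

/-- The height of a polynomial curve in the direction `v`. -/
def heightPoly {n : ℕ} (p : Fin n → ℝ[X]) (v : EucSpace n) : ℝ[X] := ∑ i, C (v i) * p i

theorem eval_heightPoly {n : ℕ} (p : Fin n → ℝ[X]) (v : EucSpace n) (t : ℝ) :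
    (heightPoly p v).eval t = inner ℝ v (polyCurve p t) := by
  simp [heightPoly, polyCurve, eval_finsetSum, PiLp.inner_apply, mul_comm]

theorem coeff_heightPoly {n : ℕ} (p : Fin n → ℝ[X]) (v : EucSpace n) (k : ℕ) :
    (heightPoly p v).coeff k = ∑ i, v i * (p i).coeff k := by
  simp [heightPoly]

theorem heightPoly_neg {n : ℕ} (p : Fin n → ℝ[X]) (v : EucSpace n) :
    heightPoly p (-v) = -heightPoly p v := by
  simp [heightPoly]

/-- Some height function has degree at most `d - 2`. -/
theorem PolyKnot.exists_natDegree_heightPoly_le (κ : PolyKnot 3) (hd : 3 ≤ κ.degree) :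
    ∃ v : EucSpace 3, v ≠ 0 ∧ (heightPoly κ.comp v).natDegree ≤ κ.degree - 2 ∧
      0 ≤ (heightPoly κ.comp v).leadingCoeff := by
  suffices h : ∃ v : EucSpace 3, v ≠ 0 ∧ (heightPoly κ.comp v).natDegree ≤ κ.degree - 2 by
    obtain ⟨v, hv, hdeg⟩ := h
    rcases le_total 0 (heightPoly κ.comp v).leadingCoeff with h0 | h0
    · exact ⟨v, hv, hdeg, h0⟩
    · refine ⟨-v, neg_ne_zero.2 hv, ?_, ?_⟩
      · rwa [heightPoly_neg, natDegree_neg]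
      · rw [heightPoly_neg, leadingCoeff_neg]; linarith
  let a : ℕ → (EucSpace 3 →ₗ[ℝ] ℝ) := fun k =>
    { toFun := fun v => ∑ i, v i * (κ.comp i).coeff k
      map_add' := fun v w => by simp [add_mul, Finset.sum_add_distrib]
      map_smul' := fun r v => by simp [Finset.mul_sum, mul_assoc] }
  -- Two linear forms on a three-dimensional space have a common nonzero zero.
  have hker := LinearMap.ker_ne_bot_of_finrank_lt
    (f := (a κ.degree).prod (a (κ.degree - 1))) (by simp)
  obtain ⟨v, hv, hv0⟩ := Submodule.exists_mem_ne_zero_of_ne_bot hker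
  rw [LinearMap.mem_ker] at hv
  have h1 : (heightPoly κ.comp v).coeff κ.degree = 0 := by
    rw [coeff_heightPoly]; exact congrArg Prod.fst hv
  have h2 : (heightPoly κ.comp v).coeff (κ.degree - 1) = 0 := by
    rw [coeff_heightPoly]; exact congrArg Prod.snd hv
  refine ⟨v, hv0, natDegree_le_iff_coeff_eq_zero.2 fun k hk => ?_⟩
  rcases lt_or_ge κ.degree k with h3 | h3
  · rw [coeff_heightPoly]
    refine Finset.sum_eq_zero fun i _ => ?_
    have h4 : (κ.comp i).natDegree ≤ κ.degree :=
      Finset.le_sup (f := fun i => (κ.comp i).natDegree) (Finset.mem_univ i)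
    rw [coeff_eq_zero_of_natDegree_lt (h4.trans_lt h3), mul_zero]
  · rcases (by omega : k = κ.degree ∨ k = κ.degree - 1) with rfl | rfl
    · exact h1
    · exact h2

theorem PolyKnot.exists_bridgeNumber_le (κ : PolyKnot 3) (hd : 3 ≤ κ.degree) :
    ∃ N : ℕ, κ.completion.bridgeNumber ≤ N ∧ 2 * N + 1 ≤ κ.degree := by
  obtain ⟨v, hv, hdeg, hl⟩ := κ.exists_natDegree_heightPoly_le hd
  obtain ⟨L, hL⟩ := exists_equiv_snd_eq_inner hv
  have hγ : IsClosedEmbedding (L ∘ polyCurve κ.comp) :=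
    L.toHomeomorph.isClosedEmbedding.comp κ.isClosedEmbedding
  have hsnd : ∀ t, ((L ∘ polyCurve κ.comp) t).2 = (heightPoly κ.comp v).eval t := fun t => by
    rw [eval_heightPoly, Function.comp_apply, hL]
  rcases Nat.eq_zero_or_pos (heightPoly κ.comp v).natDegree with h0 | h0
  -- Constant height: the bound `1` is admissible exactly because `d ≥ 3`.
  · refine ⟨1, ?_, by omega⟩
    refine κ.bridgeNumber_le_of_hasClosing hv hL ?_
    refine hasClosing_of_planar hγ (a := (heightPoly κ.comp v).coeff 0) fun t => ?_
    rw [hsnd, eq_C_of_natDegree_eq_zero h0]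
    simp
  · have hl' : 0 < (heightPoly κ.comp v).leadingCoeff := by
      refine lt_of_le_of_ne hl fun h => ?_
      rw [leadingCoeff_eq_zero.1 h.symm, natDegree_zero] at h0
      exact lt_irrefl _ h0
    obtain ⟨m, hm, hm2⟩ := Polynomial.encard_isLocalMax_le h0
      (Polynomial.tendsto_atTop_of_leadingCoeff_pos h0 hl')
    refine ⟨m + 1, ?_, by omega⟩
    refine κ.bridgeNumber_le_of_hasClosing hv hL ?_
    have := hasClosing_of_polynomial_height hγ.continuous hγ.injective hsnd h0 hl'
    rw [hm] at this
    exact_mod_cast this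

end

theorem mainTheorem7 (κ : PolyKnot 3) (d : ℕ) (hd : κ.degree = d) (hd3 : 3 ≤ d) :
    ∃ b : ℕ, κ.completion.bridgeNumber = (b : ℕ∞) ∧ (b : ℝ) ≤ (1 / 2) * ((d : ℝ) - 1) := by
  subst hd
  obtain ⟨N, hN, hN2⟩ := κ.exists_bridgeNumber_le hd3
  obtain ⟨b, hb⟩ := ENat.ne_top_iff_exists.1 (ne_top_of_le_ne_top (ENat.natCast_ne_top N) hN)
  refine ⟨b, hb.symm, ?_⟩
  rw [← hb] at hN
  have h1 : b ≤ N := by exact_mod_cast hN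
  have h2 : 2 * (b : ℝ) + 1 ≤ κ.degree := by exact_mod_cast (by omega : 2 * b + 1 ≤ κ.degree)
  linarith
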